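/- Let $a>0$, $b<0$ and $\varepsilon\neq 0$ be real numbers, and for $d=(d_1,\dots,d_6)\in\mathbb{R}^6$ consider the planar system $$\dot x=y,\qquad \dot y=-x-\frac{2b}{a^2}x^3+\varepsilon\,(d_3+d_2x^2+d_1x^4+d_4y^2+d_5x^6+d_6y^4)\,y ,$$ which for $d=0$ is Hamiltonian with a center at the origin. Then at least five limit cycles can bifurcate from this center: for every neighbourhood $U$ of the origin in $\mathbb{R}^2$ and every neighbourhood $W$ of $0$ in $\mathbb{R}^6$ there is $d\in W$ such that the system with coefficients $d$ has at least five limit cycles contained in $U$. Here a limit cycle is a periodic orbit (of a non-constant periodic solution) having a neighbourhood that contains no other periodic orbit. -/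

import Mathlib

open Topology

/-- The vector field on the plane of the system
`x' = y`, `y' = -x - (2b/a²) x³ + ε Q₁(x, y)` with
`Q₁(x, y) = (d₃ + d₂ x² + d₁ x⁴ + d₄ y² + d₅ x⁶ + d₆ y⁴) y`.
The coefficients `(d₁, …, d₆)` are `(d 0, …, d 5)`. -/
noncomputable def rayleighLienardField (a b ε : ℝ) (d : Fin 6 → ℝ) (p : ℝ × ℝ) : ℝ × ℝ :=
  (p.2,
    -p.1 - 2 * b / a ^ 2 * p.1 ^ 3
      + ε * ((d 2 + d 1 * p.1 ^ 2 + d 0 * p.1 ^ 4 + d 3 * p.2 ^ 2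
          + d 4 * p.1 ^ 6 + d 5 * p.2 ^ 4) * p.2))

/-- `Γ` is a periodic orbit of the autonomous planar vector field `X`: the trace of a
non-constant periodic solution defined for all times. -/
def IsPeriodicOrbit (X : ℝ × ℝ → ℝ × ℝ) (Γ : Set (ℝ × ℝ)) : Prop :=
  ∃ (γ : ℝ → ℝ × ℝ) (T : ℝ), 0 < T ∧ IsIntegralCurve γ (fun _ => X) ∧
    Function.Periodic γ T ∧ (∃ t, γ t ≠ γ 0) ∧ Γ = Set.range γ

/-- A limit cycle is a periodic orbit that is isolated among the periodic orbits: some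
neighbourhood of it contains no other periodic orbit. -/
def IsLimitCycle (X : ℝ × ℝ → ℝ × ℝ) (Γ : Set (ℝ × ℝ)) : Prop :=
  IsPeriodicOrbit X Γ ∧
    ∃ U : Set (ℝ × ℝ), IsOpen U ∧ Γ ⊆ U ∧
      ∀ Γ' : Set (ℝ × ℝ), IsPeriodicOrbit X Γ' → Γ' ⊆ U → Γ' = Γ

/-- In the family `X` of planar vector fields, at least `k` limit cycles bifurcate from the
point `p` at the parameter value `l₀`: in every neighbourhood of `p`, and for parameter values
arbitrarily close to `l₀`, there are at least `k` limit cycles. -/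
def LimitCyclesBifurcate {L : Type*} [TopologicalSpace L] (X : L → ℝ × ℝ → ℝ × ℝ)
    (l₀ : L) (p : ℝ × ℝ) (k : ℕ) : Prop :=
  ∀ U ∈ 𝓝 p, ∀ W ∈ 𝓝 l₀, ∃ l ∈ W,
    (k : ℕ∞) ≤ {Γ : Set (ℝ × ℝ) | IsLimitCycle (X l) Γ ∧ Γ ⊆ U}.encard

/-!
After the scaling `(x, y) ↦ (k x, k y)` the parameter `μ = -b k² / a²` is small, and the system is
the harmonic oscillator perturbed by the cubic term `2 μ x³` of a Duffing equation and by a damping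
of higher order in `μ`. Circles of radius `√n`, `1 ≤ n ≤ 5`, become limit cycles if the average of
the energy rate has simple zeros at the values `n` of the Duffing energy `h`.

The damping terms available are `1, x², x⁴, y², x⁶, y⁴` times `y`, and to first order their averaged
energy rates cannot be made proportional to `h (h - 1) ⋯ (h - 5)` without a further contribution to
the power `h⁶`. It comes from the damping `y² - 3 x² + 6 μ x⁴`, whose dissipation is an exact
derivative along the Duffing flow: taken larger than the rest, it changes the averaged energy only
at third order, and this third-order rate completes the polynomial.

All averaging is done by exact algebra: subtracting derivatives along the flow from the energy rate
amounts to adding polynomial corrections to the energy. The derivative of the corrected energy is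
`μ¹⁴` times a function of `h` with simple zeros, up to a relative error of order `μ`. Near a simple
zero this rate changes sign, so the displacement of the corrected energy over one turn vanishes
somewhere and yields a periodic orbit; it is strictly monotone in the radius, so that two periodic
orbits in the same annulus coincide.
-/

open Set Filter Real Function
open scoped NNReal

section ScalarEquation

/-- `β` solves the scalar equation `ρ' = f θ ρ` for all `θ` and stays in `I`. -/
def IsSolutionIn (f : ℝ → ℝ → ℝ) (I : Set ℝ) (β : ℝ → ℝ) : Prop :=
  ∀ θ, HasDerivAt β (f θ (β θ)) θ ∧ β θ ∈ I

/-- `G` is the orbital derivative of `v` for the scalar equation `ρ' = f θ ρ` in `I`: the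
derivative of `v` along solutions, for which one solution through the given point suffices. -/
def HasOrbitalDeriv (f v G : ℝ → ℝ → ℝ) (I : Set ℝ) : Prop :=
  ∀ (β : ℝ → ℝ) (θ : ℝ), β θ ∈ I → HasDerivAt β (f θ (β θ)) θ →
    HasDerivAt (fun s => v s (β s)) (G θ (β θ)) θ

variable {f v G : ℝ → ℝ → ℝ} {I : Set ℝ} {T : ℝ} {K : ℝ≥0}

theorem HasOrbitalDeriv.neg (h : HasOrbitalDeriv f v G I) :
    HasOrbitalDeriv f (fun θ ρ => -v θ ρ) (fun θ ρ => -G θ ρ) I :=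
  fun β θ hI hβ => (h β θ hI hβ).neg

theorem HasOrbitalDeriv.lt_of_pos (h : HasOrbitalDeriv f v G I) (hv : Continuous ↿v) (hT : 0 < T)
    {α : ℝ → ℝ} (hα : ∀ t ∈ Icc 0 T, HasDerivWithinAt α (f t (α t)) (Icc 0 T) t)
    (hI : ∀ t ∈ Icc 0 T, α t ∈ I) (hpos : ∀ t ∈ Icc 0 T, 0 < G t (α t)) :
    v 0 (α 0) < v T (α T) := by
  have hcont : ContinuousOn (fun t => v t (α t)) (Icc 0 T) :=
    hv.comp_continuousOn (continuousOn_id.prodMk fun t ht => (hα t ht).continuousWithinAt)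
  refine strictMonoOn_of_deriv_pos (convex_Icc 0 T) hcont (fun t ht => ?_)
    (left_mem_Icc.2 hT.le) (right_mem_Icc.2 hT.le) hT
  have ht' := interior_subset ht
  have hαt := (hα t ht').hasDerivAt (mem_interior_iff_mem_nhds.1 ht)
  rw [(h α t (hI t ht') hαt).deriv]
  exact hpos t ht'

theorem HasOrbitalDeriv.strictMono_sub (h : HasOrbitalDeriv f v G I)
    (hG : ∀ θ, StrictMonoOn (G θ) I) {β₁ β₂ : ℝ → ℝ} (h₁ : IsSolutionIn f I β₁)
    (h₂ : IsSolutionIn f I β₂) (hlt : ∀ θ, β₁ θ < β₂ θ) :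
    StrictMono fun θ => v θ (β₂ θ) - v θ (β₁ θ) := by
  refine strictMono_of_deriv_pos fun θ => ?_
  rw [((h β₂ θ (h₂ θ).2 (h₂ θ).1).fun_sub (h β₁ θ (h₁ θ).2 (h₁ θ).1)).deriv]
  exact sub_pos.2 (hG θ (h₁ θ).2 (h₂ θ).2 (hlt θ))

/-- Two distinct solutions never cross, so the difference of `v` along them would be strictly
monotone. -/
theorem HasOrbitalDeriv.solution_unique (h : HasOrbitalDeriv f v G I)
    (hG : ∀ θ, StrictMonoOn (G θ) I) (hf : ∀ θ, LipschitzOnWith K (f θ) I) {β₁ β₂ : ℝ → ℝ}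
    (h₁ : IsSolutionIn f I β₁) (h₂ : IsSolutionIn f I β₂) {θ₁ θ₂ : ℝ} (hθ : θ₁ < θ₂)
    (hv₁ : v θ₁ (β₁ θ₁) = v θ₂ (β₁ θ₂)) (hv₂ : v θ₁ (β₂ θ₁) = v θ₂ (β₂ θ₂)) : β₁ = β₂ := by
  by_contra hne
  have hdisjoint : ∀ θ, β₁ θ ≠ β₂ θ := fun θ heq =>
    hne (ODE_solution_unique_univ (s := fun _ => I) hf h₁ h₂ heq)
  have hcont : Continuous fun θ => β₂ θ - β₁ θ :=
    continuous_iff_continuousAt.2 fun θ => ((h₂ θ).1.sub (h₁ θ).1).continuousAt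
  have hsign : (∀ θ, β₁ θ < β₂ θ) ∨ ∀ θ, β₂ θ < β₁ θ := by
    by_contra! hcross
    obtain ⟨⟨s, hs⟩, t, ht⟩ := hcross
    obtain ⟨θ, hθ⟩ := mem_range_of_exists_le_of_exists_ge hcont
      ⟨s, sub_nonpos.2 hs⟩ ⟨t, sub_nonneg.2 ht⟩
    exact hdisjoint θ (sub_eq_zero.1 hθ).symm
  rcases hsign with hlt | hlt
  · have := h.strictMono_sub hG h₁ h₂ hlt hθ
    simp only [hv₁, hv₂, lt_irrefl] at this
  · have := h.strictMono_sub hG h₂ h₁ hlt hθ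
    simp only [hv₁, hv₂, lt_irrefl] at this

theorem hasDerivAt_zero_of_periodic {β : ℝ → ℝ} {d : ℝ} (hT : 0 < T) (hβ : Periodic β T)
    (h₀ : HasDerivWithinAt β d (Icc 0 T) 0) (h₁ : HasDerivWithinAt β d (Icc 0 T) T) :
    HasDerivAt β d 0 := by
  have hright : HasDerivWithinAt β d (Ici 0) 0 :=
    h₀.mono_of_mem_nhdsWithin (Icc_mem_nhdsGE hT)
  have hleft : HasDerivWithinAt β d (Iic 0) 0 := by
    have hT' : HasDerivWithinAt β d (Iic T) (0 + T) := by
      rw [zero_add]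
      exact h₁.mono_of_mem_nhdsWithin (Icc_mem_nhdsLE hT)
    have hmaps : MapsTo (· + T) (Iic 0) (Iic T) := fun s (hs : s ≤ 0) => by simpa using hs
    simpa only [mul_one, hβ.funext, comp_def] using
      hT'.comp (0 : ℝ) ((hasDerivAt_id' (0 : ℝ)).add_const T).hasDerivWithinAt hmaps
  simpa only [Iic_union_Ici, hasDerivWithinAt_univ] using hleft.union hright

theorem exists_periodic_extension {α : ℝ → ℝ} (hT : 0 < T) (hf : Periodic f T)
    (hα : ∀ t ∈ Icc 0 T, HasDerivWithinAt α (f t (α t)) (Icc 0 T) t) (hreturn : α T = α 0)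
    (hI : ∀ t ∈ Icc 0 T, α t ∈ I) : ∃ β, Periodic β T ∧ IsSolutionIn f I β := by
  set β : ℝ → ℝ := fun t => α (toIcoMod hT 0 t) with hβdef
  have hβ : Periodic β T := fun t => by simp only [hβdef, toIcoMod_add_right]
  have hβα : ∀ t ∈ Icc 0 T, β t = α t := fun t ht => by
    rcases eq_or_lt_of_le ht.2 with rfl | hlt
    · rw [hβ.eq, hreturn]
      simp only [hβdef, toIcoMod_apply_left]
    · simp only [hβdef, (toIcoMod_eq_self hT).2 ⟨ht.1, hlt.trans_eq (zero_add T).symm⟩]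
  have hwithin : ∀ t ∈ Icc 0 T, HasDerivWithinAt β (f t (β t)) (Icc 0 T) t := fun t ht => by
    rw [hβα t ht]
    exact (hα t ht).congr hβα (hβα t ht)
  have hperiod : ∀ t ∈ Ico 0 T, HasDerivAt β (f t (β t)) t := fun t ht => by
    rcases eq_or_lt_of_le ht.1 with rfl | hlt
    · have hend := hwithin T (right_mem_Icc.2 hT.le)
      rw [hβ.eq, hf.eq] at hend
      exact hasDerivAt_zero_of_periodic hT hβ (hwithin 0 (left_mem_Icc.2 hT.le)) hend
    · exact (hwithin t (Ico_subset_Icc_self ht)).hasDerivAt (Icc_mem_nhds hlt ht.2)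
  have hmod : ∀ t, toIcoMod hT 0 t ∈ Ico 0 T := fun t => by
    simpa only [zero_add] using toIcoMod_mem_Ico hT 0 t
  refine ⟨β, hβ, fun t => ⟨?_, hI _ (Ico_subset_Icc_self (hmod t))⟩⟩
  have hs := hperiod _ (hmod t)
  rw [toIcoMod, zsmul_eq_mul] at hs
  have hs' := hs.comp_sub_const t (toIcoDiv hT 0 t * T)
  simpa only [hβ.sub_int_mul_eq, hf.sub_int_mul_eq] using hs'

/-- Clamping the unknown to the interval makes the equation globally Lipschitz; the bound on `f`
keeps the solutions away from the clamped region. -/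
theorem exists_solutions_continuousOn_initial {ρ₀ κ M : ℝ} (hκ : 0 < κ) (hT : 0 < T)
    (hcont : ∀ ρ ∈ Icc (ρ₀ - 2 * κ) (ρ₀ + 2 * κ), Continuous fun θ => f θ ρ)
    (hlip : ∀ θ, LipschitzOnWith K (f θ) (Icc (ρ₀ - 2 * κ) (ρ₀ + 2 * κ)))
    (hbound : ∀ θ, ∀ ρ ∈ Icc (ρ₀ - 2 * κ) (ρ₀ + 2 * κ), |f θ ρ| ≤ M) (hM : M * T ≤ κ / 2) :
    ∃ α : ℝ → ℝ → ℝ, ContinuousOn (fun ρ => α ρ T) (Icc (ρ₀ - κ) (ρ₀ + κ)) ∧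
      ∀ ρ ∈ Icc (ρ₀ - κ) (ρ₀ + κ), α ρ 0 = ρ ∧ ∀ t ∈ Icc 0 T,
        HasDerivWithinAt (α ρ) (f t (α ρ t)) (Icc 0 T) t ∧ |α ρ t - ρ| ≤ κ / 2 := by
  have hI : ρ₀ - 2 * κ ≤ ρ₀ + 2 * κ := by linarith
  set clamp : ℝ → ℝ := fun ρ => projIcc _ _ hI ρ with hclamp
  have hmem : ∀ ρ, clamp ρ ∈ Icc (ρ₀ - 2 * κ) (ρ₀ + 2 * κ) := fun ρ => (projIcc _ _ hI ρ).2
  have hM₀ : 0 ≤ M := (abs_nonneg _).trans (hbound 0 ρ₀ ⟨by linarith, by linarith⟩)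
  have hpl : IsPicardLindelof (fun t ρ => f t (clamp ρ)) (tmin := 0) (tmax := T)
      ⟨0, left_mem_Icc.2 hT.le⟩ ρ₀ (2 * κ).toNNReal κ.toNNReal M.toNNReal (K * 1) := by
    refine ⟨fun t _ => (hlip t).comp (LipschitzWith.projIcc hI).lipschitzOnWith
      fun x _ => hmem x, fun x _ => (hcont _ (hmem x)).continuousOn, fun t _ x _ => ?_, ?_⟩
    · simpa only [Real.coe_toNNReal _ hM₀, Real.norm_eq_abs] using hbound t _ (hmem x)
    · simp only [Real.coe_toNNReal _ hM₀, Real.coe_toNNReal _ (mul_pos two_pos hκ).le,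
        Real.coe_toNNReal _ hκ.le, sub_zero, sub_self, max_eq_left hT.le]
      linarith
  obtain ⟨α, hα, _, hα_lip⟩ :=
    hpl.exists_forall_mem_closedBall_eq_hasDerivWithinAt_lipschitzOnWith
  rw [Real.coe_toNNReal _ hκ.le, Real.closedBall_eq_Icc] at hα hα_lip
  refine ⟨α, (hα_lip T (right_mem_Icc.2 hT.le)).continuousOn,
    fun ρ hρ => ⟨(hα ρ hρ).1, fun t ht => ?_⟩⟩
  obtain ⟨hinit, hderiv⟩ := hα ρ hρ
  have hclose : |α ρ t - ρ| ≤ κ / 2 := by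
    have hmvt := (convex_Icc 0 T).norm_image_sub_le_of_norm_hasDerivWithin_le hderiv
      (fun s _ => hbound s _ (hmem _)) (left_mem_Icc.2 hT.le) ht
    rw [hinit, sub_zero, Real.norm_eq_abs, Real.norm_eq_abs, abs_of_nonneg ht.1] at hmvt
    exact hmvt.trans ((mul_le_mul_of_nonneg_left ht.2 hM₀).trans hM)
  have hunclamped : clamp (α ρ t) = α ρ t := by
    have := abs_le.1 hclose
    simp only [hclamp, projIcc_of_mem hI ⟨by linarith [hρ.1], by linarith [hρ.2]⟩]
  have ht' := hderiv t ht
  rw [hunclamped] at ht'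
  exact ⟨ht', hclose⟩

/-- The displacement of `v` over one period is positive at the outer end of the interval of
initial values and negative at the inner end, hence zero in between. -/
theorem HasOrbitalDeriv.exists_periodic_solution {ρ₀ κ M : ℝ}
    (h : HasOrbitalDeriv f v G (Icc (ρ₀ - 2 * κ) (ρ₀ + 2 * κ))) (hκ : 0 < κ) (hT : 0 < T)
    (hf : Periodic f T)
    (hcont : ∀ ρ ∈ Icc (ρ₀ - 2 * κ) (ρ₀ + 2 * κ), Continuous fun θ => f θ ρ)
    (hlip : ∀ θ, LipschitzOnWith K (f θ) (Icc (ρ₀ - 2 * κ) (ρ₀ + 2 * κ)))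
    (hbound : ∀ θ, ∀ ρ ∈ Icc (ρ₀ - 2 * κ) (ρ₀ + 2 * κ), |f θ ρ| ≤ M) (hM : M * T ≤ κ / 2)
    (hv : Continuous ↿v) (hvT : v T = v 0)
    (hinj : InjOn (v 0) (Icc (ρ₀ - 2 * κ) (ρ₀ + 2 * κ)))
    (hG : ∀ θ, StrictMonoOn (G θ) (Icc (ρ₀ - 2 * κ) (ρ₀ + 2 * κ)))
    (hneg : ∀ θ, G θ (ρ₀ - κ / 2) < 0) (hpos : ∀ θ, 0 < G θ (ρ₀ + κ / 2)) :
    ∃ β, Periodic β T ∧ IsSolutionIn f (Ioo (ρ₀ - 2 * κ) (ρ₀ + 2 * κ)) β := by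
  set I := Icc (ρ₀ - 2 * κ) (ρ₀ + 2 * κ)
  obtain ⟨α, hαT, hα⟩ := exists_solutions_continuousOn_initial hκ hT hcont hlip hbound hM
  have hmem : ∀ ρ ∈ Icc (ρ₀ - κ) (ρ₀ + κ), ∀ t ∈ Icc 0 T,
      α ρ t ∈ Ioo (ρ₀ - 2 * κ) (ρ₀ + 2 * κ) := fun ρ hρ t ht => by
    have := abs_le.1 ((hα ρ hρ).2 t ht).2
    exact ⟨by linarith [hρ.1], by linarith [hρ.2]⟩
  have hmem' := fun ρ hρ t ht => Ioo_subset_Icc_self (hmem ρ hρ t ht)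
  have hinner_mem : ρ₀ - κ ∈ Icc (ρ₀ - κ) (ρ₀ + κ) := left_mem_Icc.2 (by linarith)
  have houter_mem : ρ₀ + κ ∈ Icc (ρ₀ - κ) (ρ₀ + κ) := right_mem_Icc.2 (by linarith)
  have hinner : v T (α (ρ₀ - κ) T) < v 0 (α (ρ₀ - κ) 0) :=
    neg_lt_neg_iff.1 <| h.neg.lt_of_pos hv.neg hT (fun t ht => ((hα _ hinner_mem).2 t ht).1)
      (hmem' _ hinner_mem) fun t ht => neg_pos.2 <|
        ((hG t).monotoneOn (hmem' _ hinner_mem t ht) ⟨by linarith, by linarith⟩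
          (by linarith [abs_le.1 ((hα _ hinner_mem).2 t ht).2])).trans_lt (hneg t)
  have houter : v 0 (α (ρ₀ + κ) 0) < v T (α (ρ₀ + κ) T) :=
    h.lt_of_pos hv hT (fun t ht => ((hα _ houter_mem).2 t ht).1) (hmem' _ houter_mem)
      fun t ht => (hpos t).trans_le <|
        (hG t).monotoneOn ⟨by linarith, by linarith⟩ (hmem' _ houter_mem t ht)
          (by linarith [abs_le.1 ((hα _ houter_mem).2 t ht).2])
  rw [(hα _ hinner_mem).1, hvT] at hinner
  rw [(hα _ houter_mem).1, hvT] at houter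
  have hv₀ : Continuous (v 0) := hv.comp (Continuous.prodMk_right 0)
  obtain ⟨ρ, hρ, hdisp⟩ := intermediate_value_Icc (by linarith)
    ((hv₀.comp_continuousOn hαT).sub hv₀.continuousOn)
    (show (0 : ℝ) ∈ Icc _ _ from ⟨(sub_neg.2 hinner).le, (sub_pos.2 houter).le⟩)
  have hfix : α ρ T = ρ := hinj (hmem' ρ hρ T (right_mem_Icc.2 hT.le))
    ⟨by linarith [hρ.1], by linarith [hρ.2]⟩ (sub_eq_zero.1 hdisp)
  exact exists_periodic_extension hT hf (fun t ht => ((hα ρ hρ).2 t ht).1)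
    (hfix.trans (hα ρ hρ).1.symm) (hmem ρ hρ)

end ScalarEquation

section PolarCoordinates

/-- The point of the plane with clockwise angle `θ` and logarithmic radius `ρ`: the solutions of
the harmonic oscillator `x' = y`, `y' = -x` turn clockwise with unit speed. -/
noncomputable def polarPt (θ ρ : ℝ) : ℝ × ℝ := (exp ρ * cos θ, -(exp ρ * sin θ))

/-- The open annulus of the points with logarithmic radius in `(a, b)`. -/
def polarAnnulus (a b : ℝ) : Set (ℝ × ℝ) :=
  {p | p.1 ^ 2 + p.2 ^ 2 ∈ Ioo (exp (2 * a)) (exp (2 * b))}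

/-- The planar field of the perturbed harmonic oscillator `x' = y`, `y' = -x + e (x, y)`. -/
def oscField (e : ℝ × ℝ → ℝ) (p : ℝ × ℝ) : ℝ × ℝ := (p.2, -p.1 + e p)

/-- The derivative of the logarithmic radius along `oscField e`. -/
noncomputable def radSpeed (e : ℝ × ℝ → ℝ) (θ ρ : ℝ) : ℝ :=
  -(sin θ * exp (-ρ) * e (polarPt θ ρ))

/-- The derivative of the clockwise angle along `oscField e`. -/
noncomputable def angSpeed (e : ℝ × ℝ → ℝ) (θ ρ : ℝ) : ℝ :=
  1 - cos θ * exp (-ρ) * e (polarPt θ ρ)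

/-- The right-hand side of the equation for the logarithmic radius of a solution of `oscField e`
as a function of its angle. -/
noncomputable def polarSlope (e : ℝ × ℝ → ℝ) (θ ρ : ℝ) : ℝ := radSpeed e θ ρ / angSpeed e θ ρ

/-- The function `V` is differentiable and its derivative along the vector field `X` is `g`. -/
def HasLieDeriv (X : ℝ × ℝ → ℝ × ℝ) (V g : ℝ × ℝ → ℝ) : Prop :=
  ∀ p, ∃ V' : ℝ × ℝ →L[ℝ] ℝ, HasFDerivAt V V' p ∧ V' (X p) = g p

theorem sq_add_sq_polarPt (θ ρ : ℝ) :
    (polarPt θ ρ).1 ^ 2 + (polarPt θ ρ).2 ^ 2 = exp (2 * ρ) := by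
  simp only [polarPt, two_mul, Real.exp_add]
  linear_combination exp ρ ^ 2 * sin_sq_add_cos_sq θ

theorem polarPt_mem_polarAnnulus {θ ρ a b : ℝ} :
    polarPt θ ρ ∈ polarAnnulus a b ↔ ρ ∈ Ioo a b := by
  simp only [polarAnnulus, mem_ofPred_eq, sq_add_sq_polarPt, mem_Ioo, Real.exp_lt_exp,
    mul_lt_mul_iff_right₀ (zero_lt_two' ℝ)]

theorem isOpen_polarAnnulus (a b : ℝ) : IsOpen (polarAnnulus a b) :=
  isOpen_Ioo.preimage (f := fun p : ℝ × ℝ => p.1 ^ 2 + p.2 ^ 2) (by fun_prop)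

theorem continuous_polarPt : Continuous ↿polarPt := by
  unfold polarPt
  fun_prop

theorem periodic_polarPt : Periodic polarPt (2 * π) := fun θ => by
  funext ρ
  simp only [polarPt, cos_add_two_pi, sin_add_two_pi]

theorem periodic_angSpeed (e : ℝ × ℝ → ℝ) : Periodic (angSpeed e) (2 * π) := fun θ => by
  funext ρ
  simp only [angSpeed, cos_add_two_pi, periodic_polarPt θ]

theorem periodic_radSpeed (e : ℝ × ℝ → ℝ) : Periodic (radSpeed e) (2 * π) := fun θ => by
  funext ρ
  simp only [radSpeed, sin_add_two_pi, periodic_polarPt θ]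

theorem periodic_polarSlope (e : ℝ × ℝ → ℝ) : Periodic (polarSlope e) (2 * π) := fun θ => by
  funext ρ
  simp only [polarSlope, periodic_radSpeed e θ, periodic_angSpeed e θ]

theorem cexp_eq_polarPt (θ ρ : ℝ) :
    Complex.exp (ρ + θ * Complex.I) = ⟨(polarPt θ ρ).1, -(polarPt θ ρ).2⟩ := by
  apply Complex.ext
  · simp [polarPt, Complex.exp_re]
  · simp [polarPt, Complex.exp_im]

theorem polarPt_eq_polarPt {θ θ' ρ ρ' : ℝ} (h : polarPt θ ρ = polarPt θ' ρ') :
    ρ = ρ' ∧ ∃ k : ℤ, θ = θ' + k * (2 * π) := by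
  have hexp : Complex.exp (ρ + θ * Complex.I) = Complex.exp (ρ' + θ' * Complex.I) := by
    rw [cexp_eq_polarPt, cexp_eq_polarPt, h]
  obtain ⟨k, hk⟩ := Complex.exp_eq_exp_iff_exists_int.1 hexp
  exact ⟨by simpa using congrArg Complex.re hk, k, by simpa using congrArg Complex.im hk⟩

theorem oscField_polarPt (e : ℝ × ℝ → ℝ) (θ ρ : ℝ) :
    oscField e (polarPt θ ρ) = radSpeed e θ ρ • polarPt θ ρ
      + angSpeed e θ ρ • ((polarPt θ ρ).2, -(polarPt θ ρ).1) := by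
  have hexp : exp ρ * exp (-ρ) = 1 := by rw [← Real.exp_add, add_neg_cancel, exp_zero]
  simp only [radSpeed, angSpeed, oscField]
  generalize e (polarPt θ ρ) = E
  simp only [polarPt, Prod.smul_mk, Prod.mk_add_mk, smul_eq_mul, Prod.mk.injEq]
  constructor
  · ring
  · linear_combination -E * (sin θ ^ 2 + cos θ ^ 2) * hexp - E * sin_sq_add_cos_sq θ

theorem hasDerivAt_polarPt {e : ℝ × ℝ → ℝ} {φ ρ : ℝ → ℝ} {t c : ℝ}
    (hφ : HasDerivAt φ (c * angSpeed e (φ t) (ρ t)) t)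
    (hρ : HasDerivAt ρ (c * radSpeed e (φ t) (ρ t)) t) :
    HasDerivAt (fun s => polarPt (φ s) (ρ s)) (c • oscField e (polarPt (φ t) (ρ t))) t := by
  refine ((hρ.exp.mul hφ.cos).prodMk (hρ.exp.mul hφ.sin).neg).congr_deriv ?_
  rw [oscField_polarPt]
  simp only [polarPt, Prod.smul_mk, Prod.mk_add_mk, smul_eq_mul, Prod.mk.injEq]
  constructor <;> ring

theorem exists_log_lift {z z' : ℝ → ℂ} (hz : ∀ t, HasDerivAt z (z' t) t) (hz' : Continuous z')
    (hne : ∀ t, z t ≠ 0) :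
    ∃ w : ℝ → ℂ, ∀ t, Complex.exp (w t) = z t ∧ HasDerivAt w (z' t / z t) t := by
  have hcont : Continuous fun t => z' t / z t :=
    hz'.div (continuous_iff_continuousAt.2 fun t => (hz t).continuousAt) hne
  set w : ℝ → ℂ := fun t => Complex.log (z 0) + ∫ s in (0 : ℝ)..t, z' s / z s with hwdef
  have hw : ∀ t, HasDerivAt w (z' t / z t) t := fun t =>
    (hcont.integral_hasStrictDerivAt 0 t).hasDerivAt.const_add _
  have hquot : ∀ t, HasDerivAt (fun s => z s * Complex.exp (-w s)) 0 t := fun t => by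
    refine ((hz t).mul (hw t).fun_neg.cexp).congr_deriv ?_
    field_simp [hne t]
    ring
  refine ⟨w, fun t => ⟨?_, hw t⟩⟩
  have hconst := is_const_of_deriv_eq_zero (fun t => (hquot t).differentiableAt)
    (fun t => (hquot t).deriv) t 0
  have hw₀ : Complex.exp (w 0) = z 0 := by
    simp only [hwdef, intervalIntegral.integral_same, add_zero, Complex.exp_log (hne 0)]
  simp only [Complex.exp_neg, hw₀, mul_inv_cancel₀ (hne 0)] at hconst
  exact (eq_of_mul_inv_eq_one hconst).symm

/-- In the complex coordinate `z = x - i y` the system reads `z' = i z - i e`, so that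
`log z = ρ + i θ` satisfies `ρ' + i θ' = i - i e / z`. -/
theorem exists_polar_lift {e : ℝ × ℝ → ℝ} (he : Continuous e) {γ : ℝ → ℝ × ℝ}
    (hγ : IsIntegralCurve γ fun _ => oscField e) (hne : ∀ t, γ t ≠ 0) :
    ∃ φ ρ : ℝ → ℝ, ∀ t, γ t = polarPt (φ t) (ρ t) ∧
      HasDerivAt φ (angSpeed e (φ t) (ρ t)) t ∧ HasDerivAt ρ (radSpeed e (φ t) (ρ t)) t := by
  have hγc : Continuous γ := continuous_iff_continuousAt.2 fun t => (hγ t).continuousAt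
  set z : ℝ → ℂ := fun t => (γ t).1 - (γ t).2 * Complex.I with hzdef
  have hz : ∀ t, HasDerivAt z ((γ t).2 - (-(γ t).1 + e (γ t) : ℝ) * Complex.I) t := fun t =>
    ((hasFDerivAt_fst (𝕜 := ℝ) (p := γ t)).comp_hasDerivAt t (hγ t)).ofReal_comp.sub
      (((hasFDerivAt_snd (𝕜 := ℝ) (p := γ t)).comp_hasDerivAt t (hγ t)).ofReal_comp.mul_const _)
  have hz₀ : ∀ t, z t ≠ 0 := fun t h => hne t <| Prod.ext
    (by simpa [hzdef] using congrArg Complex.re h) (by simpa [hzdef] using congrArg Complex.im h)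
  obtain ⟨w, hw⟩ := exists_log_lift hz (by fun_prop) hz₀
  have hpolar : ∀ t, γ t = polarPt (w t).im (w t).re := fun t => by
    have h := cexp_eq_polarPt (w t).im (w t).re
    rw [Complex.re_add_im, (hw t).1] at h
    exact Prod.ext (by simpa [hzdef] using congrArg Complex.re h)
      (by simpa [hzdef] using congrArg Complex.im h)
  have hw' : ∀ t, HasDerivAt w (radSpeed e (w t).im (w t).re
      + angSpeed e (w t).im (w t).re * Complex.I) t := fun t => by
    refine (hw t).2.congr_deriv ?_
    have hfield := oscField_polarPt e (w t).im (w t).re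
    rw [← hpolar t, oscField] at hfield
    obtain ⟨hx, hy⟩ := Prod.ext_iff.1 hfield
    rw [div_eq_iff (hz₀ t)]
    apply Complex.ext
    · simpa [hzdef] using hx
    · simpa [hzdef, neg_add_eq_sub, sub_eq_add_neg] using congrArg Neg.neg hy
  refine ⟨fun t => (w t).im, fun t => (w t).re, fun t => ⟨hpolar t, ?_, ?_⟩⟩
  · exact ((Complex.imCLM.hasFDerivAt (x := w t)).comp_hasDerivAt t (hw' t)).congr_deriv (by simp)
  · exact ((Complex.reCLM.hasFDerivAt (x := w t)).comp_hasDerivAt t (hw' t)).congr_deriv (by simp)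

theorem exists_inverse_of_le_deriv {h h' : ℝ → ℝ} {c : ℝ} (hc : 0 < c)
    (hd : ∀ t, HasDerivAt h (h' t) t) (hle : ∀ t, c ≤ h' t) :
    ∃ Φ : ℝ ≃o ℝ, (∀ t, Φ t = h t) ∧ ∀ s, HasDerivAt Φ.symm (h' (Φ.symm s))⁻¹ s := by
  have hpos : ∀ t, 0 < h' t := fun t => hc.trans_le (hle t)
  have hmono : StrictMono h := strictMono_of_deriv_pos fun t => by
    rw [(hd t).deriv]
    exact hpos t
  have hgrowth : ∀ ⦃s t⦄, s ≤ t → c * (t - s) ≤ h t - h s :=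
    mul_sub_le_image_sub_of_le_deriv (fun t => (hd t).differentiableAt) fun t => by
      rw [(hd t).deriv]
      exact hle t
  have hsurj : Surjective h := fun s =>
    mem_range_of_exists_le_of_exists_ge
      (continuous_iff_continuousAt.2 fun t => (hd t).continuousAt)
      ⟨-(|s - h 0| / c), by
        have := hgrowth (neg_nonpos.2 (div_nonneg (abs_nonneg (s - h 0)) hc.le))
        rw [zero_sub, neg_neg, mul_div_cancel₀ _ hc.ne'] at this
        linarith [neg_abs_le (s - h 0)]⟩
      ⟨|s - h 0| / c, by
        have := hgrowth (div_nonneg (abs_nonneg (s - h 0)) hc.le)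
        rw [sub_zero, mul_div_cancel₀ _ hc.ne'] at this
        linarith [le_abs_self (s - h 0)]⟩
  set Φ := hmono.orderIsoOfSurjective h hsurj
  exact ⟨Φ, fun t => rfl, fun s => .of_local_left_inverse Φ.symm.continuous.continuousAt
    (hd _) (hpos _).ne' (.of_forall Φ.apply_symm_apply)⟩

theorem exists_reparametrization {B : ℝ → ℝ} {c C P : ℝ} (hB : Continuous B) (hc : 0 < c)
    (hmem : ∀ θ, B θ ∈ Icc c C) (hP : 0 < P) (hper : Periodic B P) :
    ∃ (φ : ℝ → ℝ) (T : ℝ), 0 < T ∧ Surjective φ ∧ (∀ t, HasDerivAt φ (B (φ t)) t) ∧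
      ∀ t, φ (t + T) = φ t + P := by
  have hpos : ∀ θ, 0 < B θ := fun θ => hc.trans_le (hmem θ).1
  have hcont : Continuous fun θ => (B θ)⁻¹ := hB.inv₀ fun θ => (hpos θ).ne'
  set τ : ℝ → ℝ := fun θ => ∫ s in (0 : ℝ)..θ, (B s)⁻¹ with hτdef
  obtain ⟨Φ, hΦ, hΦ'⟩ := exists_inverse_of_le_deriv (inv_pos.2 ((hpos 0).trans_le (hmem 0).2))
    (fun θ => (hcont.integral_hasStrictDerivAt 0 θ).hasDerivAt)
    fun θ => inv_anti₀ (hpos θ) (hmem θ).2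
  have hshift : ∀ θ, τ (θ + P) = τ θ + τ P := fun θ => by
    have hint : ∀ s t, IntervalIntegrable (fun θ => (B θ)⁻¹) MeasureTheory.volume s t :=
      hcont.intervalIntegrable
    have hper' : Periodic (fun θ => (B θ)⁻¹) P := fun θ => by simp only [hper θ]
    have := hper'.intervalIntegral_add_eq θ 0
    rw [zero_add] at this
    simp only [hτdef, ← this,
      intervalIntegral.integral_add_adjacent_intervals (hint _ _) (hint _ _)]
  refine ⟨Φ.symm, τ P, ?_, Φ.symm.surjective, fun t => ?_, fun t => ?_⟩
  · exact intervalIntegral.intervalIntegral_pos_of_pos (hcont.intervalIntegrable _ _)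
      (fun θ => inv_pos.2 (hpos θ)) hP
  · simpa only [inv_inv] using hΦ' t
  · rw [Φ.symm_apply_eq, hΦ]
    exact (congrArg (· + τ P) ((hΦ _).symm.trans (Φ.apply_symm_apply t))).symm.trans
      (hshift _).symm

variable {e V g : ℝ × ℝ → ℝ} {a b c C : ℝ} {I : Set ℝ}

theorem HasLieDeriv.hasOrbitalDeriv (hV : HasLieDeriv (oscField e) V g)
    (hang : ∀ θ, ∀ ρ ∈ I, angSpeed e θ ρ ≠ 0) :
    HasOrbitalDeriv (polarSlope e) (fun θ ρ => V (polarPt θ ρ))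
      (fun θ ρ => g (polarPt θ ρ) / angSpeed e θ ρ) I := fun β θ hI hβ => by
  obtain ⟨V', hV', hg⟩ := hV (polarPt θ (β θ))
  have hcurve := hasDerivAt_polarPt (e := e) (φ := id) (ρ := β) (c := (angSpeed e θ (β θ))⁻¹)
    ((hasDerivAt_id θ).congr_deriv (inv_mul_cancel₀ (hang θ _ hI)).symm)
    (hβ.congr_deriv (inv_mul_eq_div _ _).symm)
  refine (hV'.comp_hasDerivAt θ hcurve).congr_deriv ?_
  rw [map_smul, id, hg, smul_eq_mul, inv_mul_eq_div]

theorem isPeriodicOrbit_range_polarPt (he : Continuous e) (hc : 0 < c)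
    (hang : ∀ θ, ∀ ρ ∈ I, angSpeed e θ ρ ∈ Icc c C) {β : ℝ → ℝ} (hper : Periodic β (2 * π))
    (hβ : IsSolutionIn (polarSlope e) I β) :
    IsPeriodicOrbit (oscField e) (range fun θ => polarPt θ (β θ)) := by
  have hβc : Continuous β := continuous_iff_continuousAt.2 fun θ => (hβ θ).1.continuousAt
  have hcurve : Continuous fun θ => polarPt θ (β θ) :=
    continuous_polarPt.comp (continuous_id.prodMk hβc)
  have hang' : ∀ θ, angSpeed e θ (β θ) ∈ Icc c C := fun θ => hang θ _ (hβ θ).2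
  obtain ⟨φ, T, hT, hsurj, hφ, hφT⟩ := exists_reparametrization
    (B := fun θ => angSpeed e θ (β θ)) (by unfold angSpeed; fun_prop) hc hang' two_pi_pos
    fun θ => by simp only [hper θ, periodic_angSpeed e θ]
  refine ⟨fun t => polarPt (φ t) (β (φ t)), T, hT, fun t => ?_, fun t => ?_, ?_,
    (hsurj.range_comp fun θ => polarPt θ (β θ)).symm⟩
  · have hradius : HasDerivAt (fun t => β (φ t)) (1 * radSpeed e (φ t) (β (φ t))) t := by
      refine ((hβ (φ t)).1.comp t (hφ t)).congr_deriv ?_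
      rw [one_mul, polarSlope, div_mul_cancel₀ _ (hc.trans_le (hang' _).1).ne']
    simpa only [one_smul] using hasDerivAt_polarPt ((hφ t).congr_deriv (one_mul _).symm) hradius
  · simp only [hφT, hper (φ t), periodic_polarPt (φ t)]
  · obtain ⟨t, ht⟩ := hsurj (φ 0 + π)
    refine ⟨t, fun heq => ?_⟩
    obtain ⟨-, k, hk⟩ := polarPt_eq_polarPt heq
    have hodd : (1 : ℝ) = k * 2 := mul_right_cancel₀ pi_ne_zero (by linarith)
    have : (1 : ℤ) = k * 2 := by exact_mod_cast hodd
    lia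

theorem exists_polar_solution_of_isPeriodicOrbit (he : Continuous e) (hc : 0 < c)
    (hang : ∀ θ, ∀ ρ ∈ Ioo a b, c ≤ angSpeed e θ ρ) {Γ : Set (ℝ × ℝ)}
    (hΓ : IsPeriodicOrbit (oscField e) Γ) (hsub : Γ ⊆ polarAnnulus a b) :
    ∃ β, IsSolutionIn (polarSlope e) (Ioo a b) β ∧ Γ = range (fun θ => polarPt θ (β θ)) ∧
      ∃ (θ : ℝ) (k : ℤ), θ < θ + k * (2 * π) ∧ β (θ + k * (2 * π)) = β θ := by
  obtain ⟨γ, T, hT, hγ, hγT, -, rfl⟩ := hΓ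
  have hne : ∀ t, γ t ≠ 0 := fun t h => by
    have := (hsub (mem_range_self t)).1
    simp only [h, Prod.fst_zero, Prod.snd_zero, zero_pow two_ne_zero, add_zero] at this
    exact (exp_pos _).not_gt this
  obtain ⟨φ, ρ, hpolar⟩ := exists_polar_lift he hγ hne
  have hρ : ∀ t, ρ t ∈ Ioo a b := fun t => by
    rw [← polarPt_mem_polarAnnulus (θ := φ t), ← (hpolar t).1]
    exact hsub (mem_range_self t)
  obtain ⟨Φ, hΦ, hΦ'⟩ := exists_inverse_of_le_deriv hc (fun t => (hpolar t).2.1)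
    fun t => hang _ _ (hρ t)
  have hφΦ : ∀ θ, φ (Φ.symm θ) = θ := fun θ => (hΦ _).symm.trans (Φ.apply_symm_apply θ)
  have hΦφ : ∀ t, Φ.symm (φ t) = t := fun t => by rw [← hΦ, Φ.symm_apply_apply]
  refine ⟨fun θ => ρ (Φ.symm θ), fun θ => ⟨?_, hρ _⟩, ?_, ?_⟩
  · have hchain := (hpolar (Φ.symm θ)).2.2.comp θ (hΦ' θ)
    rwa [hφΦ, ← div_eq_mul_inv] at hchain
  · rw [← Φ.symm.surjective.range_comp γ]
    exact congrArg range (funext fun θ => by rw [comp_apply, (hpolar _).1, hφΦ])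
  · have hclosed : polarPt (φ T) (ρ T) = polarPt (φ 0) (ρ 0) := by
      rw [← (hpolar T).1, ← (hpolar 0).1, hγT.eq]
    obtain ⟨hρT, k, hk⟩ := polarPt_eq_polarPt hclosed
    refine ⟨φ 0, k, ?_, ?_⟩
    · rw [← hk, ← hΦ, ← hΦ]
      exact Φ.strictMono hT
    · simp only [← hk, hΦφ, hρT]

theorem isLimitCycle_range_polarPt {K : ℝ≥0} (he : Continuous e)
    (hV : HasLieDeriv (oscField e) V g) (hc : 0 < c)
    (hang : ∀ θ, ∀ ρ ∈ Ioo a b, angSpeed e θ ρ ∈ Icc c C)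
    (hlip : ∀ θ, LipschitzOnWith K (polarSlope e θ) (Ioo a b))
    (hmono : ∀ θ, StrictMonoOn (fun ρ => g (polarPt θ ρ) / angSpeed e θ ρ) (Ioo a b))
    {β : ℝ → ℝ} (hper : Periodic β (2 * π)) (hβ : IsSolutionIn (polarSlope e) (Ioo a b) β) :
    IsLimitCycle (oscField e) (range fun θ => polarPt θ (β θ)) := by
  refine ⟨isPeriodicOrbit_range_polarPt he hc hang hper hβ, polarAnnulus a b,
    isOpen_polarAnnulus a b, ?_, fun Γ hΓ hsub => ?_⟩
  · rintro _ ⟨θ, rfl⟩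
    exact polarPt_mem_polarAnnulus.2 (hβ θ).2
  obtain ⟨α, hα, rfl, θ, k, hlt, hreturn⟩ := exists_polar_solution_of_isPeriodicOrbit he hc
    (fun θ ρ hρ => (hang θ ρ hρ).1) hΓ hsub
  have horb := hV.hasOrbitalDeriv fun θ ρ hρ => (hc.trans_le (hang θ ρ hρ).1).ne'
  have hclosed : polarPt (θ + k * (2 * π)) = polarPt θ := periodic_polarPt.int_mul k θ
  rw [horb.solution_unique hmono hlip hα hβ hlt (by simp only [hclosed, hreturn])
    (by simp only [hclosed, hper.int_mul k θ])]

end PolarCoordinates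

section Perturbation

theorem HasLieDeriv.const_mul {X : ℝ × ℝ → ℝ × ℝ} {V g : ℝ × ℝ → ℝ} (h : HasLieDeriv X V g)
    (c : ℝ) : HasLieDeriv X (fun p => c * V p) fun p => c * g p := fun p => by
  obtain ⟨V', hV', hg⟩ := h p
  exact ⟨c • V', hV'.const_mul c, by rw [smul_apply, hg, smul_eq_mul]⟩

theorem exists_isLimitCycle_of_hasLieDeriv {e V g : ℝ × ℝ → ℝ} {ρ₀ κ c C : ℝ} {K : ℝ≥0}
    (he : Continuous e) (hV : HasLieDeriv (oscField e) V g) (hκ : 0 < κ) (hc : 0 < c)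
    (hang : ∀ θ, ∀ ρ ∈ Icc (ρ₀ - 2 * κ) (ρ₀ + 2 * κ), angSpeed e θ ρ ∈ Icc c C)
    (hbound : ∀ θ, ∀ ρ ∈ Icc (ρ₀ - 2 * κ) (ρ₀ + 2 * κ), |polarSlope e θ ρ| ≤ κ / 16)
    (hlip : ∀ θ, LipschitzOnWith K (polarSlope e θ) (Icc (ρ₀ - 2 * κ) (ρ₀ + 2 * κ)))
    (hinj : InjOn (fun ρ => V (polarPt 0 ρ)) (Icc (ρ₀ - 2 * κ) (ρ₀ + 2 * κ)))
    (hmono : ∀ θ, StrictMonoOn (fun ρ => g (polarPt θ ρ) / angSpeed e θ ρ)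
      (Icc (ρ₀ - 2 * κ) (ρ₀ + 2 * κ)))
    (hneg : ∀ θ, g (polarPt θ (ρ₀ - κ / 2)) < 0) (hpos : ∀ θ, 0 < g (polarPt θ (ρ₀ + κ / 2))) :
    ∃ Γ, IsLimitCycle (oscField e) Γ ∧ Γ ⊆ polarAnnulus (ρ₀ - 2 * κ) (ρ₀ + 2 * κ) := by
  have hang_pos : ∀ θ, ∀ ρ ∈ Icc (ρ₀ - 2 * κ) (ρ₀ + 2 * κ), 0 < angSpeed e θ ρ :=
    fun θ ρ hρ => hc.trans_le (hang θ ρ hρ).1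
  have hVc : Continuous V := continuous_iff_continuousAt.2 fun p =>
    let ⟨_, hV', _⟩ := hV p
    hV'.continuousAt
  have hpt : ∀ ρ, Continuous fun θ => polarPt θ ρ := fun ρ =>
    continuous_polarPt.comp (Continuous.prodMk_left ρ)
  have hcont : ∀ ρ ∈ Icc (ρ₀ - 2 * κ) (ρ₀ + 2 * κ), Continuous fun θ => polarSlope e θ ρ :=
    fun ρ hρ => by
      refine Continuous.div ?_ ?_ fun θ => (hang_pos θ ρ hρ).ne'
      · unfold radSpeed; fun_prop
      · unfold angSpeed; fun_prop
  have hv : polarPt (2 * π) = polarPt 0 := periodic_polarPt.eq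
  obtain ⟨β, hper, hβ⟩ := (hV.hasOrbitalDeriv
      fun θ ρ hρ => (hang_pos θ ρ hρ).ne').exists_periodic_solution hκ two_pi_pos
    (periodic_polarSlope e) hcont hlip hbound (by nlinarith [pi_le_four])
    (hVc.comp continuous_polarPt) (by simp only [hv]) hinj hmono
    (fun θ => div_neg_of_neg_of_pos (hneg θ) (hang_pos θ _ ⟨by linarith, by linarith⟩))
    fun θ => div_pos (hpos θ) (hang_pos θ _ ⟨by linarith, by linarith⟩)
  refine ⟨_, isLimitCycle_range_polarPt he hV hc (fun θ ρ hρ => hang θ ρ (Ioo_subset_Icc_self hρ))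
    (fun θ => (hlip θ).mono Ioo_subset_Icc_self) (fun θ => (hmono θ).mono Ioo_subset_Icc_self)
    hper hβ, ?_⟩
  rintro _ ⟨θ, rfl⟩
  exact polarPt_mem_polarAnnulus.2 (hβ θ).2

section Uniform

variable {h : ℝ → ℝ → ℝ → ℝ} {T η₀ : ℝ} {S I : Set ℝ}

theorem eventually_forall_mem_of_periodic (hT : 0 < T) (hper : ∀ η, Periodic (h η) T)
    (hI : IsCompact I) (hS : IsOpen S) (hcont : ∀ θ, ∀ ρ ∈ I, ContinuousAt ↿h (η₀, θ, ρ))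
    (hmem : ∀ θ, ∀ ρ ∈ I, h η₀ θ ρ ∈ S) : ∀ᶠ η in 𝓝 η₀, ∀ θ, ∀ ρ ∈ I, h η θ ρ ∈ S := by
  have hK : IsCompact (Icc 0 T ×ˢ I) := isCompact_Icc.prod hI
  have hcompact := hK.eventually_forall_of_forall_eventually (x₀ := η₀)
    (P := fun η q => h η q.1 q.2 ∈ S) fun q hq =>
      (hcont q.1 q.2 hq.2).eventually_mem (hS.mem_nhds (hmem q.1 q.2 hq.2))
  filter_upwards [hcompact] with η hη θ ρ hρ
  obtain ⟨θ', hθ', heq⟩ := (hper η).exists_mem_Ico₀ hT θ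
  rw [heq]
  exact hη (θ', ρ) ⟨Ico_subset_Icc_self hθ', hρ⟩

theorem hasDerivAt_of_contDiffAt_uncurry {η θ ρ : ℝ} (hd : ContDiffAt ℝ 1 ↿h (η, θ, ρ)) :
    HasDerivAt (h η θ) (fderiv ℝ ↿h (η, θ, ρ) (0, 0, 1)) ρ := by
  have hline : HasDerivAt (fun r : ℝ => (η, θ, r)) (0, 0, 1) ρ :=
    (hasDerivAt_const ρ η).prodMk ((hasDerivAt_const ρ θ).prodMk (hasDerivAt_id' ρ))
  exact (hd.differentiableAt one_ne_zero).hasFDerivAt.comp_hasDerivAt ρ hline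

theorem eventually_forall_hasDerivAt_mem (hT : 0 < T) (hper : ∀ η, Periodic (h η) T)
    (hI : IsCompact I) (hS : IsOpen S) (hd : ∀ θ, ∀ ρ ∈ I, ContDiffAt ℝ 1 ↿h (η₀, θ, ρ))
    (hmem : ∀ θ, ∀ ρ ∈ I, deriv (h η₀ θ) ρ ∈ S) :
    ∀ᶠ η in 𝓝 η₀, ∀ θ, ∀ ρ ∈ I, ∃ d ∈ S, HasDerivAt (h η θ) d ρ := by
  have hK : IsCompact (Icc 0 T ×ˢ I) := isCompact_Icc.prod hI
  have hcompact := hK.eventually_forall_of_forall_eventually (x₀ := η₀)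
    (P := fun η q => ∃ d ∈ S, HasDerivAt (h η q.1) d q.2) fun q hq => by
      have hq' := hd q.1 q.2 hq.2
      have hcont : ContinuousAt (fun z => fderiv ℝ ↿h z (0, 0, 1)) (η₀, q) :=
        (hq'.fderiv_right (m := 0) le_rfl).continuousAt.clm_apply continuousAt_const
      have hS' : fderiv ℝ ↿h (η₀, q) (0, 0, 1) ∈ S := by
        rw [← (hasDerivAt_of_contDiffAt_uncurry hq').deriv]
        exact hmem q.1 q.2 hq.2
      filter_upwards [hq'.eventually (by simp), hcont.eventually_mem (hS.mem_nhds hS')]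
        with z hz hzS
      exact ⟨_, hzS, hasDerivAt_of_contDiffAt_uncurry hz⟩
  filter_upwards [hcompact] with η hη θ ρ hρ
  obtain ⟨θ', hθ', heq⟩ := (hper η).exists_mem_Ico₀ hT θ
  rw [heq]
  exact hη (θ', ρ) ⟨Ico_subset_Icc_self hθ', hρ⟩

theorem eventually_forall_strictMonoOn (hT : 0 < T) (hper : ∀ η, Periodic (h η) T)
    (hI : IsCompact I) (hconv : Convex ℝ I) (hd : ∀ θ, ∀ ρ ∈ I, ContDiffAt ℝ 1 ↿h (η₀, θ, ρ))
    (hpos : ∀ θ, ∀ ρ ∈ I, 0 < deriv (h η₀ θ) ρ) :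
    ∀ᶠ η in 𝓝 η₀, ∀ θ, StrictMonoOn (h η θ) I := by
  filter_upwards [eventually_forall_hasDerivAt_mem hT hper hI isOpen_Ioi hd hpos] with η hη θ
  choose! d hd_pos hd using hη θ
  refine strictMonoOn_of_deriv_pos hconv (fun ρ hρ => (hd ρ hρ).continuousAt.continuousWithinAt)
    fun ρ hρ => ?_
  rw [(hd ρ (interior_subset hρ)).deriv]
  exact hd_pos ρ (interior_subset hρ)

theorem eventually_forall_lipschitzOnWith {K : ℝ≥0} (hT : 0 < T) (hper : ∀ η, Periodic (h η) T)
    (hI : IsCompact I) (hconv : Convex ℝ I) (hd : ∀ θ, ∀ ρ ∈ I, ContDiffAt ℝ 1 ↿h (η₀, θ, ρ))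
    (hlt : ∀ θ, ∀ ρ ∈ I, |deriv (h η₀ θ) ρ| < K) :
    ∀ᶠ η in 𝓝 η₀, ∀ θ, LipschitzOnWith K (h η θ) I := by
  filter_upwards [eventually_forall_hasDerivAt_mem hT hper hI isOpen_Ioo hd
    fun θ ρ hρ => abs_lt.1 (hlt θ ρ hρ)] with η hη θ
  choose! d hd_lt hd using hη θ
  exact hconv.lipschitzOnWith_of_nnnorm_hasDerivWithin_le
    (fun ρ hρ => (hd ρ hρ).hasDerivWithinAt) fun ρ hρ => NNReal.coe_le_coe.1 <| by
      simpa only [coe_nnnorm, Real.norm_eq_abs] using (abs_lt.2 (hd_lt ρ hρ)).le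

end Uniform

section Family

variable {e V G : ℝ → ℝ × ℝ → ℝ} {F a : ℝ → ℝ} {I : Set ℝ} {c ρ₀ δ : ℝ}

theorem contDiff_comp_polarPt (hV : ContDiff ℝ 1 ↿V) :
    ContDiff ℝ 1 ↿fun η θ ρ => V η (polarPt θ ρ) :=
  hV.comp (f := fun q : ℝ × ℝ × ℝ => (q.1, polarPt q.2.1 q.2.2)) (by unfold polarPt; fun_prop)

theorem contDiff_angSpeed (he : ContDiff ℝ 1 ↿e) : ContDiff ℝ 1 ↿fun η => angSpeed (e η) := by
  have hpolar := contDiff_comp_polarPt he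
  simp only [HasUncurry.uncurry, id, angSpeed] at hpolar ⊢
  exact contDiff_const.sub (ContDiff.mul (by fun_prop) hpolar)

theorem contDiff_radSpeed (he : ContDiff ℝ 1 ↿e) : ContDiff ℝ 1 ↿fun η => radSpeed (e η) := by
  have hpolar := contDiff_comp_polarPt he
  simp only [HasUncurry.uncurry, id, radSpeed] at hpolar ⊢
  exact (ContDiff.mul (by fun_prop) hpolar).neg

theorem angSpeed_eq_one {f : ℝ × ℝ → ℝ} (hf : ∀ p, f p = 0) (θ ρ : ℝ) : angSpeed f θ ρ = 1 := by
  rw [angSpeed, hf, mul_zero, sub_zero]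

theorem polarSlope_eq_zero {f : ℝ × ℝ → ℝ} (hf : ∀ p, f p = 0) (θ ρ : ℝ) :
    polarSlope f θ ρ = 0 := by
  rw [polarSlope, radSpeed, hf, mul_zero, neg_zero, zero_div]

theorem eventually_angSpeed_mem_Icc (he : ContDiff ℝ 1 ↿e) (he₀ : ∀ p, e 0 p = 0)
    (hI : IsCompact I) : ∀ᶠ η in 𝓝 0, ∀ θ, ∀ ρ ∈ I, angSpeed (e η) θ ρ ∈ Icc (1 / 2) 2 := by
  refine (eventually_forall_mem_of_periodic (S := Ioo (1 / 2) 2) two_pi_pos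
    (fun η => periodic_angSpeed (e η)) hI isOpen_Ioo
    (fun θ ρ _ => (contDiff_angSpeed he).continuous.continuousAt) fun θ ρ _ => ?_).mono
    fun η hη θ ρ hρ => Ioo_subset_Icc_self (hη θ ρ hρ)
  rw [angSpeed_eq_one he₀]
  norm_num

theorem contDiffAt_div_angSpeed {h : ℝ → ℝ → ℝ → ℝ} (he : ContDiff ℝ 1 ↿e)
    (he₀ : ∀ p, e 0 p = 0) (hh : ContDiff ℝ 1 ↿h) (θ ρ : ℝ) :
    ContDiffAt ℝ 1 ↿(fun η θ ρ => h η θ ρ / angSpeed (e η) θ ρ) (0, θ, ρ) :=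
  hh.contDiffAt.div (contDiff_angSpeed he).contDiffAt <|
    (angSpeed_eq_one he₀ θ ρ).trans_ne one_ne_zero

theorem eventually_abs_polarSlope_le {M : ℝ} (he : ContDiff ℝ 1 ↿e) (he₀ : ∀ p, e 0 p = 0)
    (hI : IsCompact I) (hM : 0 < M) :
    ∀ᶠ η in 𝓝 0, ∀ θ, ∀ ρ ∈ I, |polarSlope (e η) θ ρ| ≤ M := by
  refine (eventually_forall_mem_of_periodic (S := Ioo (-M) M) two_pi_pos
    (fun η => periodic_polarSlope (e η)) hI isOpen_Ioo
    (fun θ ρ _ => (contDiffAt_div_angSpeed he he₀ (contDiff_radSpeed he) θ ρ).continuousAt)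
    fun θ ρ _ => ?_).mono fun η hη θ ρ hρ => (abs_lt.2 (hη θ ρ hρ)).le
  rw [polarSlope_eq_zero he₀]
  exact ⟨neg_lt_zero.2 hM, hM⟩

theorem eventually_lipschitzOnWith_polarSlope (he : ContDiff ℝ 1 ↿e) (he₀ : ∀ p, e 0 p = 0)
    (hI : IsCompact I) (hconv : Convex ℝ I) :
    ∀ᶠ η in 𝓝 0, ∀ θ, LipschitzOnWith 1 (polarSlope (e η) θ) I := by
  refine eventually_forall_lipschitzOnWith two_pi_pos (fun η => periodic_polarSlope (e η)) hI hconv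
    (fun θ ρ _ => contDiffAt_div_angSpeed he he₀ (contDiff_radSpeed he) θ ρ) fun θ ρ _ => ?_
  rw [funext (polarSlope_eq_zero he₀ θ), deriv_const, abs_zero, NNReal.coe_one]
  exact one_pos

theorem hasDerivAt_comp_exp_two_mul {ρ : ℝ} (hF : DifferentiableAt ℝ F (exp (2 * ρ))) :
    HasDerivAt (fun ρ => F (exp (2 * ρ))) (deriv F (exp (2 * ρ)) * (exp (2 * ρ) * 2)) ρ :=
  hF.hasDerivAt.comp ρ (((hasDerivAt_id ρ).const_mul 2).exp.congr_deriv (by simp))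

theorem strictMonoOn_comp_exp_two_mul (hF : Differentiable ℝ F) (hconv : Convex ℝ I)
    (hpos : ∀ ρ ∈ I, 0 < deriv F (exp (2 * ρ))) :
    StrictMonoOn (fun ρ => F (exp (2 * ρ))) I := by
  refine strictMonoOn_of_deriv_pos hconv (hF.continuous.comp (by fun_prop)).continuousOn
    fun ρ hρ => ?_
  rw [(hasDerivAt_comp_exp_two_mul (hF _)).deriv]
  exact mul_pos (hpos ρ (interior_subset hρ)) (by positivity)

theorem eventually_injOn_polarPt (hV : ContDiff ℝ 1 ↿V) (hc : 0 < c)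
    (hV₀ : ∀ p, V 0 p = c * (p.1 ^ 2 + p.2 ^ 2)) (hI : IsCompact I) (hconv : Convex ℝ I) :
    ∀ᶠ η in 𝓝 0, InjOn (fun ρ => V η (polarPt 0 ρ)) I := by
  refine (eventually_forall_strictMonoOn (h := fun η θ ρ => V η (polarPt θ ρ)) two_pi_pos
    (fun η => periodic_polarPt.comp fun p ρ => V η (p ρ)) hI hconv
    (fun θ ρ _ => (contDiff_comp_polarPt hV).contDiffAt) fun θ ρ _ => ?_).mono
    fun η hη => (hη 0).injOn
  simp only [hV₀, sq_add_sq_polarPt]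
  rw [(hasDerivAt_comp_exp_two_mul (F := (c * ·)) (by fun_prop)).deriv, deriv_const_mul_id']
  positivity

theorem eventually_strictMonoOn_rate (he : ContDiff ℝ 1 ↿e) (he₀ : ∀ p, e 0 p = 0)
    (hG : ContDiff ℝ 1 ↿G) (hF : Differentiable ℝ F) (hG₀ : ∀ p, G 0 p = F (p.1 ^ 2 + p.2 ^ 2))
    (hI : IsCompact I) (hconv : Convex ℝ I) (hpos : ∀ ρ ∈ I, 0 < deriv F (exp (2 * ρ))) :
    ∀ᶠ η in 𝓝 0, ∀ θ, StrictMonoOn (fun ρ => G η (polarPt θ ρ) / angSpeed (e η) θ ρ) I := by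
  refine eventually_forall_strictMonoOn
    (h := fun η θ ρ => G η (polarPt θ ρ) / angSpeed (e η) θ ρ) two_pi_pos (fun η θ => ?_) hI hconv
    (fun θ ρ _ => contDiffAt_div_angSpeed he he₀ (contDiff_comp_polarPt hG) θ ρ) fun θ ρ hρ => ?_
  · simp only [periodic_polarPt θ, periodic_angSpeed (e η) θ]
  · simp only [hG₀, sq_add_sq_polarPt, angSpeed_eq_one he₀, div_one]
    rw [(hasDerivAt_comp_exp_two_mul (hF _)).deriv]
    have := hpos ρ hρ
    positivity

theorem eventually_rate_mem {ρ : ℝ} {S : Set ℝ} (hG : ContDiff ℝ 1 ↿G)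
    (hG₀ : ∀ p, G 0 p = F (p.1 ^ 2 + p.2 ^ 2)) (hS : IsOpen S) (hmem : F (exp (2 * ρ)) ∈ S) :
    ∀ᶠ η in 𝓝 0, ∀ θ, G η (polarPt θ ρ) ∈ S := by
  refine (eventually_forall_mem_of_periodic (h := fun η θ ρ => G η (polarPt θ ρ)) two_pi_pos
    (fun η => periodic_polarPt.comp fun p ρ => G η (p ρ)) (isCompact_singleton (x := ρ)) hS
    (fun θ ρ _ => (contDiff_comp_polarPt hG).continuous.continuousAt) ?_).mono
    fun η hη θ => hη θ ρ rfl
  rintro θ _ rfl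
  rwa [hG₀, sq_add_sq_polarPt]

theorem exists_forall_mem_Icc_of_eventually {P : ℝ → Prop} (hP : ∀ᶠ ρ in 𝓝 ρ₀, P ρ) (hδ : 0 < δ) :
    ∃ κ > 0, 2 * κ ≤ δ ∧ ∀ ρ ∈ Icc (ρ₀ - 2 * κ) (ρ₀ + 2 * κ), P ρ := by
  obtain ⟨r, hr, hball⟩ := Metric.eventually_nhds_iff_ball.1 hP
  have hmin := min_le_left (r / 4) (δ / 2)
  refine ⟨min (r / 4) (δ / 2), by positivity, by linarith [min_le_right (r / 4) (δ / 2)],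
    fun ρ hρ => hball ρ ?_⟩
  rw [Real.ball_eq_Ioo]
  exact ⟨by linarith [hρ.1], by linarith [hρ.2]⟩

theorem eventually_exists_isLimitCycle_of_deriv_pos (he : ContDiff ℝ 1 ↿e)
    (he₀ : ∀ p, e 0 p = 0) (hV : ContDiff ℝ 1 ↿V) (hc : 0 < c)
    (hV₀ : ∀ p, V 0 p = c * (p.1 ^ 2 + p.2 ^ 2)) (hG : ContDiff ℝ 1 ↿G) (hF : ContDiff ℝ 1 F)
    (hG₀ : ∀ p, G 0 p = F (p.1 ^ 2 + p.2 ^ 2)) (ha : ∀ η ≠ 0, a η ≠ 0)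
    (hLie : ∀ η, HasLieDeriv (oscField (e η)) (V η) fun p => a η * G η p) (hδ : 0 < δ)
    (hzero : F (exp (2 * ρ₀)) = 0) (hpos : 0 < deriv F (exp (2 * ρ₀))) :
    ∀ᶠ η in 𝓝[≠] 0, ∃ Γ, IsLimitCycle (oscField (e η)) Γ ∧
      Γ ⊆ polarAnnulus (ρ₀ - δ) (ρ₀ + δ) := by
  have hF' : Continuous fun ρ => deriv F (exp (2 * ρ)) :=
    (hF.continuous_deriv le_rfl).comp (by fun_prop)
  obtain ⟨κ, hκ, hκδ, hκpos⟩ := exists_forall_mem_Icc_of_eventually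
    (hF'.continuousAt.eventually_mem (Ioi_mem_nhds hpos)) hδ
  have hI : IsCompact (Icc (ρ₀ - 2 * κ) (ρ₀ + 2 * κ)) := isCompact_Icc
  have hconv : Convex ℝ (Icc (ρ₀ - 2 * κ) (ρ₀ + 2 * κ)) := convex_Icc _ _
  have hdiff : Differentiable ℝ F := hF.differentiable one_ne_zero
  have hmono := strictMonoOn_comp_exp_two_mul hdiff hconv hκpos
  have hin : F (exp (2 * (ρ₀ - κ / 2))) < 0 := hzero ▸
    hmono ⟨by linarith, by linarith⟩ ⟨by linarith, by linarith⟩ (by linarith)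
  have hout : 0 < F (exp (2 * (ρ₀ + κ / 2))) := hzero ▸
    hmono ⟨by linarith, by linarith⟩ ⟨by linarith, by linarith⟩ (by linarith)
  filter_upwards [self_mem_nhdsWithin,
    (eventually_angSpeed_mem_Icc he he₀ hI).filter_mono nhdsWithin_le_nhds,
    (eventually_abs_polarSlope_le he he₀ hI (M := κ / 16) (by positivity)).filter_mono
      nhdsWithin_le_nhds,
    (eventually_lipschitzOnWith_polarSlope he he₀ hI hconv).filter_mono nhdsWithin_le_nhds,
    (eventually_injOn_polarPt hV hc hV₀ hI hconv).filter_mono nhdsWithin_le_nhds,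
    (eventually_strictMonoOn_rate he he₀ hG hdiff hG₀ hI hconv hκpos).filter_mono
      nhdsWithin_le_nhds,
    (eventually_rate_mem hG hG₀ isOpen_Iio hin).filter_mono nhdsWithin_le_nhds,
    (eventually_rate_mem hG hG₀ isOpen_Ioi hout).filter_mono nhdsWithin_le_nhds]
    with η hη hang hbound hlip hinj hrate hinner houter
  have hLie' := (hLie η).const_mul (a η)⁻¹
  simp only [inv_mul_cancel_left₀ (ha η hη)] at hLie'
  obtain ⟨Γ, hΓ, hsub⟩ := exists_isLimitCycle_of_hasLieDeriv
    (he.continuous.comp (Continuous.prodMk_right η)) hLie' hκ (one_half_pos (α := ℝ)) hang hbound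
    hlip (fun x hx y hy hxy => hinj hx hy (mul_left_cancel₀ (inv_ne_zero (ha η hη)) hxy)) hrate
    hinner houter
  exact ⟨Γ, hΓ, hsub.trans fun p hp => Ioo_subset_Ioo (exp_le_exp.2 (by linarith))
    (exp_le_exp.2 (by linarith)) hp⟩

theorem eventually_exists_isLimitCycle (he : ContDiff ℝ 1 ↿e) (he₀ : ∀ p, e 0 p = 0)
    (hV : ContDiff ℝ 1 ↿V) (hc : c ≠ 0) (hV₀ : ∀ p, V 0 p = c * (p.1 ^ 2 + p.2 ^ 2))
    (hG : ContDiff ℝ 1 ↿G) (hF : ContDiff ℝ 1 F) (hG₀ : ∀ p, G 0 p = F (p.1 ^ 2 + p.2 ^ 2))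
    (ha : ∀ η ≠ 0, a η ≠ 0)
    (hLie : ∀ η, HasLieDeriv (oscField (e η)) (V η) fun p => a η * G η p) (hδ : 0 < δ)
    (hzero : F (exp (2 * ρ₀)) = 0) (hsimple : deriv F (exp (2 * ρ₀)) ≠ 0) :
    ∀ᶠ η in 𝓝[≠] 0, ∃ Γ, IsLimitCycle (oscField (e η)) Γ ∧
      Γ ⊆ polarAnnulus (ρ₀ - δ) (ρ₀ + δ) := by
  set σ := deriv F (exp (2 * ρ₀)) with hσ
  refine eventually_exists_isLimitCycle_of_deriv_pos (V := fun η p => c * V η p)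
    (G := fun η p => σ * G η p) (F := fun u => σ * F u) (a := fun η => c * a η / σ) he he₀
    (contDiff_const.mul hV) (mul_self_pos.2 hc) (fun p => by rw [hV₀, mul_assoc])
    (contDiff_const.mul hG) (contDiff_const.mul hF) (fun p => by rw [hG₀])
    (fun η hη => div_ne_zero (mul_ne_zero hc (ha η hη)) hsimple) (fun η => ?_) hδ
    (by rw [hzero, mul_zero]) ?_
  · convert (hLie η).const_mul c using 2
    field_simp
  · rw [deriv_const_mul _ (hF.differentiable one_ne_zero _), ← hσ]
    exact mul_self_pos.2 hsimple

end Family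

end Perturbation

section Averaging

variable {R A : Type*} [CommRing R] [CommRing A] [Algebra R A]

theorem derivation_ofNat (D : Derivation R A A) (n : ℕ) [n.AtLeastTwo] :
    D (ofNat(n) : A) = 0 :=
  D.map_natCast n

/-- The derivation `D` is the time derivative along the solutions of the Duffing equation
`x' = y`, `y' = -x + 2 μ x³`. -/
structure IsDuffingFlow (D : Derivation R A A) (μ x y : A) : Prop where
  map_param : D μ = 0
  map_pos : D x = y
  map_vel : D y = -x + 2 * μ * x ^ 3

/-- The derivation `E` is the infinitesimal scaling of the velocity `y`, so that `D + q • E` is the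
time derivative once the damping term `q y` is added to the equation of `y`. -/
structure IsVelocityScaling (E : Derivation R A A) (μ x y : A) : Prop where
  map_param : E μ = 0
  map_pos : E x = 0
  map_vel : E y = y

/-- The first integral of the Duffing equation `x' = y`, `y' = -x + 2 μ x³`, normalised so that it
is `x ^ 2 + y ^ 2` for `μ = 0`. -/
def duffingEnergy (μ x y : A) : A := x ^ 2 + y ^ 2 - μ * x ^ 4

/-- Congruence modulo the image of the derivation `D` and the multiples of `c`. If `D` is the time
derivative along a flow, congruent functions have the same time averages along its periodic orbits
up to a multiple of `c`. -/
def AverageCongr (D : Derivation R A A) (c f g : A) : Prop :=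
  ∃ U r, f = g + D U + c * r

/-- The damping whose dissipation `y ^ 2 * exactDamping μ x y` is the time derivative of `x * y ^ 3`
along the Duffing flow, so that it has no effect on the averaged energy to first order. -/
def exactDamping (μ x y : A) : A := y ^ 2 - 3 * x ^ 2 + 6 * μ * x ^ 4

/-- Up to the factor `12`, the rate at which the damping `s * exactDamping μ x y` changes the
averaged energy at order `s ^ 3`. -/
def cubicDissipation (μ x y : A) : A :=
  -(x ^ 2 * y ^ 4 * (2 * duffingEnergy μ x y - 5 * x ^ 2 + 8 * μ * x ^ 4))

/-- The damping added to `70 * μ ^ 4 * exactDamping μ x y`, with coefficients chosen to make the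
averaged energy rate proportional to `∏ k ∈ range 6, (h - k)` in terms of the energy `h`. -/
def unfoldingDamping (μ x y : A) : A :=
  1575 * μ ^ 3 - 14385 * μ ^ 3 * x ^ 2 + (160 - 1500 * μ + 23625 * μ ^ 3) * x ^ 4
    + (-400 * μ + 4800 * μ ^ 2 - 14280 * μ ^ 3) * x ^ 6 + (-32 + 300 * μ) * y ^ 4

/-- The energy with the corrections in the damping parameter `s` that absorb all the exact terms of
its rate of change up to order `s ^ 3` included. -/
def correctedEnergy (μ s x y : A) : A :=
  let h := duffingEnergy μ x y
  20 * h - 40 * s * x * y ^ 3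
    + s ^ 2 * (60 * h ^ 2 * x ^ 2 - 150 * h * x ^ 4 + (160 * μ * h + 80) * x ^ 6
      - 165 * μ * x ^ 8 + 84 * μ ^ 2 * x ^ 10)
    - 20 * s ^ 3 * x * y ^ 3 * (12 * h * x ^ 2 - 15 * x ^ 4 + 16 * μ * x ^ 6)

/-- The total damping of the perturbed oscillator. The two powers of `μ` are matched so that the
third-order effect of the first term on the averaged energy and the first-order effect of the second
one add up to a term of order `μ ^ 14`. -/
def totalDamping (μ x y : A) : A :=
  70 * μ ^ 4 * exactDamping μ x y + 3675 * μ ^ 11 * unfoldingDamping μ x y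

variable {D E : Derivation R A A} {μ x y : A}

theorem IsDuffingFlow.map_energy (hD : IsDuffingFlow D μ x y) : D (duffingEnergy μ x y) = 0 := by
  simp only [duffingEnergy, map_add, map_sub, D.leibniz, D.leibniz_pow, hD.map_param, hD.map_pos,
    hD.map_vel, smul_eq_mul, nsmul_eq_mul, Nat.cast_ofNat, Nat.reduceSub]
  ring

/-! The corrections `U` below are found by iterating the identity
`D (x ^ n * y) = n * h * x ^ (n - 1) - (n + 1) * x ^ (n + 1) + (n + 2) * μ * x ^ (n + 3)`,
where `h` is the energy: it expresses the average of `x ^ (n + 1)` through those of lower powers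
of `x` and of multiples of `μ`. -/

theorem IsDuffingFlow.average_sq (hD : IsDuffingFlow D μ x y) :
    AverageCongr D μ (2 * y ^ 2) (duffingEnergy μ x y) := by
  refine ⟨x * y, -x ^ 4, ?_⟩
  simp only [D.leibniz, hD.map_pos, hD.map_vel, smul_eq_mul, duffingEnergy]
  ring

theorem IsDuffingFlow.average_pow_two_mul_sq (hD : IsDuffingFlow D μ x y) :
    AverageCongr D μ (8 * x ^ 2 * y ^ 2) (duffingEnergy μ x y ^ 2) := by
  have hE := hD.map_energy
  set h := duffingEnergy μ x y with hh
  refine ⟨(-h * x + 2 * x ^ 3) * y, 3 * h * x ^ 4 - 2 * x ^ 6, ?_⟩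
  simp only [map_add, map_neg, D.leibniz, D.leibniz_pow, derivation_ofNat, hE,
    hD.map_pos, hD.map_vel, smul_eq_mul, nsmul_eq_mul, Nat.cast_ofNat, Nat.reduceSub]
  simp only [hh, duffingEnergy]
  ring

theorem IsDuffingFlow.average_pow_four_mul_sq (hD : IsDuffingFlow D μ x y) :
    AverageCongr D μ (48 * x ^ 4 * y ^ 2) (3 * duffingEnergy μ x y ^ 3) := by
  have hE := hD.map_energy
  set h := duffingEnergy μ x y with hh
  refine ⟨(-3 * h ^ 2 * x - 2 * h * x ^ 3 + 8 * x ^ 5) * y,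
    9 * h ^ 2 * x ^ 4 + 10 * h * x ^ 6 - 8 * x ^ 8, ?_⟩
  simp only [map_add, map_sub, map_neg, D.leibniz, D.leibniz_pow, derivation_ofNat, hE,
    hD.map_pos, hD.map_vel, smul_eq_mul, nsmul_eq_mul, Nat.cast_ofNat, Nat.reduceSub]
  simp only [hh, duffingEnergy]
  ring

theorem IsDuffingFlow.average_pow_six_mul_sq (hD : IsDuffingFlow D μ x y) :
    AverageCongr D μ (384 * x ^ 6 * y ^ 2) (15 * duffingEnergy μ x y ^ 4) := by
  have hE := hD.map_energy
  set h := duffingEnergy μ x y with hh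
  refine ⟨(-15 * h ^ 3 * x - 10 * h ^ 2 * x ^ 3 - 8 * h * x ^ 5 + 48 * x ^ 7) * y,
    45 * h ^ 3 * x ^ 4 + 50 * h ^ 2 * x ^ 6 + 56 * h * x ^ 8 - 48 * x ^ 10, ?_⟩
  simp only [map_add, map_sub, map_neg, D.leibniz, D.leibniz_pow, derivation_ofNat, hE,
    hD.map_pos, hD.map_vel, smul_eq_mul, nsmul_eq_mul, Nat.cast_ofNat, Nat.reduceSub]
  simp only [hh, duffingEnergy]
  ring

/-- The three terms are weighted so that the orders `h ^ 3` and `μ * h ^ 4` of their averages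
cancel. -/
theorem IsDuffingFlow.average_fifth_order (hD : IsDuffingFlow D μ x y) :
    AverageCongr D (μ ^ 3) (960 * (y ^ 6 - 5 * x ^ 4 * y ^ 2 + 16 * μ * x ^ 6 * y ^ 2))
      (315 * μ ^ 2 * duffingEnergy μ x y ^ 5) := by
  have hE := hD.map_energy
  set h := duffingEnergy μ x y with hh
  refine ⟨((960 * h ^ 2 - 315 * μ ^ 2 * h ^ 4) * x - (320 * h + 210 * μ ^ 2 * h ^ 3) * x ^ 3
      - (640 + 168 * μ ^ 2 * h ^ 2) * x ^ 5 + (1600 * μ - 144 * μ ^ 2 * h) * x ^ 7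
      + 192 * μ ^ 2 * x ^ 9) * y,
    945 * h ^ 4 * x ^ 4 + 1050 * h ^ 3 * x ^ 6 + 1176 * h ^ 2 * x ^ 8 + 1296 * h * x ^ 10
      - 1152 * x ^ 12, ?_⟩
  simp only [map_add, map_sub, D.leibniz, D.leibniz_pow, derivation_ofNat, hE,
    hD.map_param, hD.map_pos, hD.map_vel, smul_eq_mul, nsmul_eq_mul, Nat.cast_ofNat, Nat.reduceSub]
  simp only [hh, duffingEnergy]
  ring

theorem IsDuffingFlow.average_sixth_order (hD : IsDuffingFlow D μ x y) :
    AverageCongr D (μ ^ 4)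
      (768 * (-2 * (y ^ 6 - 5 * x ^ 4 * y ^ 2) - 25 * μ * x ^ 6 * y ^ 2
        + 35 * μ * cubicDissipation μ x y))
      (-315 * μ ^ 3 * duffingEnergy μ x y ^ 6) := by
  have hE := hD.map_energy
  simp only [cubicDissipation]
  set h := duffingEnergy μ x y with hh
  refine ⟨((315 * μ ^ 3 * h ^ 5 - 1536 * h ^ 2) * x
      + (512 * h - 17920 * μ * h ^ 2 + 210 * μ ^ 3 * h ^ 4) * x ^ 3
      + (1024 + 34048 * μ * h + 168 * μ ^ 3 * h ^ 3) * x ^ 5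
      + (144 * μ ^ 3 * h ^ 2 - 18688 * μ - 33280 * μ ^ 2 * h) * x ^ 7
      + (33024 * μ ^ 2 + 128 * μ ^ 3 * h) * x ^ 9 - 16640 * μ ^ 3 * x ^ 11) * y,
    1280 * x ^ 14 - 1408 * h * x ^ 12 - 1296 * h ^ 2 * x ^ 10 - 1176 * h ^ 3 * x ^ 8
      - 1050 * h ^ 4 * x ^ 6 - 945 * h ^ 5 * x ^ 4, ?_⟩
  simp only [map_add, map_sub, D.leibniz, D.leibniz_pow, derivation_ofNat, hE,
    hD.map_param, hD.map_pos, hD.map_vel, smul_eq_mul, nsmul_eq_mul, Nat.cast_ofNat, Nat.reduceSub]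
  simp only [hh, duffingEnergy]
  ring

theorem IsDuffingFlow.average_unfolding (hD : IsDuffingFlow D μ x y) :
    AverageCongr D (μ ^ 4)
      (48 * (unfoldingDamping μ x y * y ^ 2 + 560 * μ * cubicDissipation μ x y))
      (-315 * μ ^ 3 * ∏ k ∈ Finset.range 6, (duffingEnergy μ x y - k)) := by
  obtain ⟨U₁, r₁, h₁⟩ := hD.average_sq
  obtain ⟨U₂, r₂, h₂⟩ := hD.average_pow_two_mul_sq
  obtain ⟨U₃, r₃, h₃⟩ := hD.average_pow_four_mul_sq
  obtain ⟨U₄, r₄, h₄⟩ := hD.average_pow_six_mul_sq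
  obtain ⟨U₅, r₅, h₅⟩ := hD.average_fifth_order
  obtain ⟨U₆, r₆, h₆⟩ := hD.average_sixth_order
  refine ⟨U₆ + 15 * μ * U₅ + μ ^ 3 * (37800 * U₁ - 86310 * U₂ + 23625 * U₃ - 1785 * U₄),
    r₆ + 15 * r₅ + (37800 * r₁ - 86310 * r₂ + 23625 * r₃ - 1785 * r₄), ?_⟩
  simp only [map_add, map_sub, D.leibniz, D.leibniz_pow, derivation_ofNat, hD.map_param,
    smul_eq_mul, smul_zero, mul_zero, add_zero, Finset.prod_range_succ,
    Finset.prod_range_zero, Nat.cast_zero, Nat.cast_one, Nat.cast_ofNat, unfoldingDamping]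
  linear_combination h₆ + 15 * μ * h₅
    + μ ^ 3 * (37800 * h₁ - 86310 * h₂ + 23625 * h₃ - 1785 * h₄)

theorem IsDuffingFlow.add_smul_param (hD : IsDuffingFlow D μ x y) (hE : IsVelocityScaling E μ x y)
    (q : A) : (D + q • E) μ = 0 := by
  rw [Derivation.add_apply, Derivation.smul_apply, hD.map_param, hE.map_param, smul_zero, add_zero]

theorem IsDuffingFlow.add_smul_pos (hD : IsDuffingFlow D μ x y) (hE : IsVelocityScaling E μ x y)
    (q : A) : (D + q • E) x = y := by
  rw [Derivation.add_apply, Derivation.smul_apply, hD.map_pos, hE.map_pos, smul_zero, add_zero]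

theorem IsDuffingFlow.add_smul_vel (hD : IsDuffingFlow D μ x y) (hE : IsVelocityScaling E μ x y)
    (q : A) : (D + q • E) y = -x + (2 * μ * x ^ 3 + q * y) := by
  rw [Derivation.add_apply, Derivation.smul_apply, hD.map_vel, hE.map_vel, smul_eq_mul, add_assoc]

theorem AverageCongr.add_smul {c f g q : A} (h : AverageCongr D c f g) (hq : c ∣ q) :
    AverageCongr (D + q • E) c f g := by
  obtain ⟨U, r, h⟩ := h
  obtain ⟨q', rfl⟩ := hq
  refine ⟨U, r - q' * E U, ?_⟩
  simp only [Derivation.add_apply, Derivation.smul_apply, smul_eq_mul]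
  linear_combination h

theorem exists_map_correctedEnergy_eq (hD : IsDuffingFlow D μ x y) (hE : IsVelocityScaling E μ x y)
    {s t p : A} (hDs : D s = 0) (hEs : E s = 0) :
    ∃ r₁ r₂, (D + (s * exactDamping μ x y + t * p) • E) (correctedEnergy μ s x y) =
      40 * t * p * y ^ 2 + 240 * s ^ 3 * cubicDissipation μ x y + s * t * r₁ + s ^ 4 * r₂ := by
  set w := 12 * duffingEnergy μ x y * x ^ 2 - 15 * x ^ 4 + 16 * μ * x ^ 6 with hw
  refine ⟨p * (-120 * x * y ^ 3 + 20 * s * y ^ 2 * w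
      - 20 * s ^ 2 * (3 * x * y ^ 3 * w + 24 * x ^ 3 * y ^ 5)),
    -20 * exactDamping μ x y * (3 * x * y ^ 3 * w + 24 * x ^ 3 * y ^ 5), ?_⟩
  simp only [hw, correctedEnergy, duffingEnergy, exactDamping, cubicDissipation,
    Derivation.add_apply, Derivation.smul_apply, map_add, map_sub, Derivation.leibniz,
    Derivation.leibniz_pow, derivation_ofNat, hDs, hEs, hD.map_param, hD.map_pos, hD.map_vel,
    hE.map_param, hE.map_pos, hE.map_vel, smul_eq_mul, nsmul_eq_mul, Nat.cast_ofNat, Nat.reduceSub]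
  ring

theorem dvd_correctedEnergy_sub (μ s x y : A) :
    s ∣ correctedEnergy μ s x y - 20 * duffingEnergy μ x y := by
  refine Dvd.intro (-40 * x * y ^ 3 + s * (60 * duffingEnergy μ x y ^ 2 * x ^ 2
    - 150 * duffingEnergy μ x y * x ^ 4 + (160 * μ * duffingEnergy μ x y + 80) * x ^ 6
    - 165 * μ * x ^ 8 + 84 * μ ^ 2 * x ^ 10) - 20 * s ^ 2 * x * y ^ 3 *
      (12 * duffingEnergy μ x y * x ^ 2 - 15 * x ^ 4 + 16 * μ * x ^ 6)) ?_
  simp only [correctedEnergy]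
  ring

theorem exists_map_energy_eq (hD : IsDuffingFlow D μ x y) (hE : IsVelocityScaling E μ x y) :
    ∃ v r, (D + totalDamping μ x y • E) (960 * duffingEnergy μ x y + μ * v) =
      μ ^ 14 * (-46305000 * ∏ k ∈ Finset.range 6, (duffingEnergy μ x y - k) + μ * r) := by
  have hconst (F : Derivation R A A) (hF : F μ = 0) (n : ℕ) : F (μ ^ n) = 0 := by
    rw [F.leibniz_pow, hF, smul_zero, smul_zero]
  have hs (F : Derivation R A A) (hF : F μ = 0) : F (70 * μ ^ 4) = 0 := by
    rw [F.leibniz, hconst F hF, derivation_ofNat, smul_zero, smul_zero, add_zero]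
  obtain ⟨r₁, r₂, hV⟩ := exists_map_correctedEnergy_eq (t := 3675 * μ ^ 11)
    (p := unfoldingDamping μ x y) hD hE (hs D hD.map_param) (hs E hE.map_param)
  rw [← totalDamping] at hV
  have hdvd : μ ^ 4 ∣ totalDamping μ x y :=
    ⟨70 * exactDamping μ x y + 3675 * μ ^ 7 * unfoldingDamping μ x y, by
      rw [totalDamping]; ring⟩
  obtain ⟨U, r, hU⟩ := hD.average_unfolding.add_smul (E := E) hdvd
  obtain ⟨v, hv⟩ := dvd_correctedEnergy_sub μ (70 * μ ^ 4) x y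
  refine ⟨3360 * μ ^ 3 * v - 147000 * μ ^ 10 * U,
    147000 * r + 48 * 257250 * r₁ + 48 * 24010000 * μ * r₂, ?_⟩
  have henergy : 960 * duffingEnergy μ x y + μ * (3360 * μ ^ 3 * v - 147000 * μ ^ 10 * U) =
      48 * correctedEnergy μ (70 * μ ^ 4) x y - 147000 * (μ ^ 11 * U) := by
    linear_combination -48 * hv
  set Δ := D + totalDamping μ x y • E
  rw [henergy, map_sub, Δ.leibniz, Δ.leibniz, Δ.leibniz, hconst Δ (hD.add_smul_param hE _),
    derivation_ofNat, derivation_ofNat, hV]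
  simp only [smul_eq_mul, mul_zero, add_zero]
  linear_combination 147000 * μ ^ 11 * hU

end Averaging

section Unfolding

open MvPolynomial

/-- The force added to the harmonic oscillator in the perturbed oscillator: the cubic term of the
Duffing equation and the damping. -/
def unfoldingForce {A : Type*} [CommRing A] (μ x y : A) : A :=
  2 * μ * x ^ 3 + totalDamping μ x y * y

/-- The value at the parameter `η` and the point `p` of a polynomial in the indeterminates
`X 0`, `X 1`, `X 2`, which stand for the parameter and the two coordinates. -/
noncomputable def evalAt (η : ℝ) (p : ℝ × ℝ) : MvPolynomial (Fin 3) ℝ →+* ℝ :=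
  eval ![η, p.1, p.2]

theorem map_unfoldingForce {A B : Type*} [CommRing A] [CommRing B] (f : A →+* B) (μ x y : A) :
    f (unfoldingForce μ x y) = unfoldingForce (f μ) (f x) (f y) := by
  simp only [unfoldingForce, totalDamping, exactDamping, unfoldingDamping, map_add, map_sub,
    map_mul, map_pow, map_neg, map_ofNat]

theorem evalAt_unfoldingForce (η : ℝ) (p : ℝ × ℝ) :
    evalAt η p (unfoldingForce (X 0) (X 1) (X 2)) = unfoldingForce η p.1 p.2 := by
  simp [map_unfoldingForce, evalAt]

theorem contDiff_evalAt (f : MvPolynomial (Fin 3) ℝ) :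
    ContDiff ℝ 1 ↿fun η p => evalAt η p f := by
  have hcoord : ContDiff ℝ 1 fun q : ℝ × ℝ × ℝ => ![q.1, q.2.1, q.2.2] :=
    contDiff_pi.2 (Fin.forall_fin_succ.2
      ⟨contDiff_fst, Fin.forall_fin_two.2 ⟨contDiff_snd.fst, contDiff_snd.snd⟩⟩)
  exact (AnalyticOnNhd.eval_mvPolynomial f).contDiff.comp hcoord

theorem hasLieDeriv_evalAt {Δ : Derivation ℝ (MvPolynomial (Fin 3) ℝ) (MvPolynomial (Fin 3) ℝ)}
    {f : MvPolynomial (Fin 3) ℝ} (h₀ : Δ (X 0) = 0) (h₁ : Δ (X 1) = X 2)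
    (h₂ : Δ (X 2) = -X 1 + f) (η : ℝ) (V : MvPolynomial (Fin 3) ℝ) :
    HasLieDeriv (oscField fun p => evalAt η p f) (fun p => evalAt η p V)
      fun p => evalAt η p (Δ V) := by
  intro p
  beta_reduce
  induction V using MvPolynomial.induction_on with
  | C a =>
    exact ⟨0, by simpa [evalAt] using hasFDerivAt_const a p, by simp⟩
  | add V W hV hW =>
    obtain ⟨V', hV', hVp⟩ := hV
    obtain ⟨W', hW', hWp⟩ := hW
    refine ⟨V' + W', by simpa only [map_add] using hV'.fun_add hW', ?_⟩
    rw [add_apply, hVp, hWp, map_add, map_add]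
  | mul_X V i hV =>
    obtain ⟨V', hV', hVp⟩ := hV
    obtain ⟨L, hL, hLp⟩ : ∃ L : ℝ × ℝ →L[ℝ] ℝ, HasFDerivAt (fun p => evalAt η p (X i)) L p ∧
        L (oscField (fun p => evalAt η p f) p) = evalAt η p (Δ (X i)) := by
      fin_cases i
      · exact ⟨0, by simpa [evalAt] using hasFDerivAt_const η p, by simp [h₀]⟩
      · exact ⟨.fst ℝ ℝ ℝ, by simpa [evalAt] using hasFDerivAt_fst,
          by simp [h₁, evalAt, oscField]⟩
      · exact ⟨.snd ℝ ℝ ℝ, by simpa [evalAt] using hasFDerivAt_snd,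
          by simp [h₂, evalAt, oscField]⟩
    refine ⟨_, by simpa only [map_mul] using hV'.fun_mul hL, ?_⟩
    simp [hVp, hLp]

theorem exists_energy_of_unfoldingForce :
    ∃ V G : MvPolynomial (Fin 3) ℝ,
      (∀ p, evalAt 0 p V = 960 * (p.1 ^ 2 + p.2 ^ 2)) ∧
      (∀ p, evalAt 0 p G = -46305000 * ∏ k ∈ Finset.range 6, (p.1 ^ 2 + p.2 ^ 2 - k)) ∧
      ∀ η, HasLieDeriv (oscField fun p => unfoldingForce η p.1 p.2) (fun p => evalAt η p V)
        fun p => η ^ 14 * evalAt η p G := by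
  let D : Derivation ℝ (MvPolynomial (Fin 3) ℝ) (MvPolynomial (Fin 3) ℝ) :=
    mkDerivation ℝ ![0, X 2, -X 1 + 2 * X 0 * X 1 ^ 3]
  let E : Derivation ℝ (MvPolynomial (Fin 3) ℝ) (MvPolynomial (Fin 3) ℝ) :=
    mkDerivation ℝ ![0, 0, X 2]
  have hD : IsDuffingFlow D (X 0) (X 1) (X 2) := by
    constructor <;> simp [D, mkDerivation_X]
  have hE : IsVelocityScaling E (X 0) (X 1) (X 2) := by
    constructor <;> simp [E, mkDerivation_X]
  obtain ⟨v, r, hV⟩ := exists_map_energy_eq hD hE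
  refine ⟨960 * duffingEnergy (X 0) (X 1) (X 2) + X 0 * v,
    -46305000 * ∏ k ∈ Finset.range 6,
      (duffingEnergy (X 0) (X 1) (X 2) - (k : MvPolynomial (Fin 3) ℝ)) + X 0 * r,
    fun p => ?_, fun p => ?_, fun η => ?_⟩
  · simp [evalAt, duffingEnergy]
  · simp [evalAt, duffingEnergy, map_prod]
  · have hLie := hasLieDeriv_evalAt (hD.add_smul_param hE _) (hD.add_smul_pos hE _)
      (hD.add_smul_vel hE (totalDamping (X 0) (X 1) (X 2))) η
      (960 * duffingEnergy (X 0) (X 1) (X 2) + X 0 * v)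
    have hfactor (p : ℝ × ℝ) (W : MvPolynomial (Fin 3) ℝ) :
        evalAt η p (X 0 ^ 14 * W) = η ^ 14 * evalAt η p W := by
      simp [evalAt]
    rw [hV, ← unfoldingForce] at hLie
    simpa only [evalAt_unfoldingForce, hfactor] using hLie

theorem deriv_prod_sub_ne_zero {ι : Type*} {s : Finset ι} {f : ι → ℝ} {i : ι}
    (hf : InjOn f s) (hi : i ∈ s) : deriv (fun u => ∏ j ∈ s, (u - f j)) (f i) ≠ 0 := by
  classical
  have hcofactor : DifferentiableAt ℝ (fun u => ∏ j ∈ s.erase i, (u - f j)) (f i) := by fun_prop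
  have hderiv := ((hasDerivAt_id' (f i)).sub_const (f i)).fun_mul hcofactor.hasDerivAt
  rw [sub_self, one_mul, zero_mul, add_zero] at hderiv
  simp only [← Finset.mul_prod_erase s _ hi]
  rw [hderiv.deriv, Finset.prod_ne_zero_iff]
  intro j hj
  rw [Finset.mem_erase] at hj
  exact sub_ne_zero.2 fun h => hj.1 (hf hi hj.2 h).symm

theorem exists_polarAnnulus_abs_sub_lt (ρ₀ : ℝ) {r : ℝ} (hr : 0 < r) :
    ∃ δ > 0, ∀ p ∈ polarAnnulus (ρ₀ - δ) (ρ₀ + δ), |p.1 ^ 2 + p.2 ^ 2 - exp (2 * ρ₀)| < r := by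
  have hcont : Continuous fun δ : ℝ => (exp (2 * (ρ₀ - δ)), exp (2 * (ρ₀ + δ))) := by fun_prop
  have hnear : ∀ᶠ δ in 𝓝 (0 : ℝ), exp (2 * ρ₀) - r < exp (2 * (ρ₀ - δ)) ∧
      exp (2 * (ρ₀ + δ)) < exp (2 * ρ₀) + r := by
    refine hcont.continuousAt.eventually_mem (s := Ioi (exp (2 * ρ₀) - r) ×ˢ Iio (exp (2 * ρ₀) + r))
      (prod_mem_nhds (Ioi_mem_nhds ?_) (Iio_mem_nhds ?_)) <;> simpa
  obtain ⟨δ, ⟨hlow, hhigh⟩, hδ⟩ :=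
    ((hnear.filter_mono nhdsWithin_le_nhds).and (self_mem_nhdsWithin (s := Ioi 0))).exists
  exact ⟨δ, hδ, fun p hp => abs_lt.2 ⟨by linarith [hp.1], by linarith [hp.2]⟩⟩

theorem eventually_exists_isLimitCycle_unfoldingForce {n : ℕ} (hn : n ∈ Ioo 0 6) :
    ∀ᶠ η in 𝓝[≠] 0, ∃ Γ, IsLimitCycle (oscField fun p => unfoldingForce η p.1 p.2) Γ ∧
      ∀ p ∈ Γ, |p.1 ^ 2 + p.2 ^ 2 - n| < 1 / 2 := by
  obtain ⟨V, G, hV, hG, hLie⟩ := exists_energy_of_unfoldingForce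
  have hexp : exp (2 * (log n / 2)) = n := by
    rw [mul_div_cancel₀ _ two_ne_zero, exp_log (Nat.cast_pos.2 hn.1)]
  obtain ⟨δ, hδ, hannulus⟩ := exists_polarAnnulus_abs_sub_lt (log n / 2) one_half_pos
  rw [hexp] at hannulus
  have hforce : ContDiff ℝ 1 ↿fun (η : ℝ) (p : ℝ × ℝ) => unfoldingForce η p.1 p.2 := by
    simpa only [evalAt_unfoldingForce] using contDiff_evalAt (unfoldingForce (X 0) (X 1) (X 2))
  have hcycle := eventually_exists_isLimitCycle (ρ₀ := log n / 2) (c := 960) (a := (· ^ 14))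
    (F := fun u => -46305000 * ∏ k ∈ Finset.range 6, (u - k)) hforce
    (fun p => by simp [unfoldingForce, totalDamping]) (contDiff_evalAt V) (by norm_num) hV
    (contDiff_evalAt G) (by fun_prop) hG (fun η hη => pow_ne_zero _ hη) hLie hδ ?_ ?_
  · filter_upwards [hcycle] with η ⟨Γ, hΓ, hsub⟩ using ⟨Γ, hΓ, fun p hp => hannulus p (hsub hp)⟩
  · rw [hexp, Finset.prod_eq_zero (Finset.mem_range.2 hn.2) (sub_self _), mul_zero]
  · rw [hexp, deriv_const_mul_field]
    exact mul_ne_zero (by norm_num)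
      (deriv_prod_sub_ne_zero Nat.cast_injective.injOn (Finset.mem_range.2 hn.2))

end Unfolding

section Scaling

variable {X Z : ℝ × ℝ → ℝ × ℝ} {k : ℝ} {Γ : Set (ℝ × ℝ)}

theorem IsPeriodicOrbit.image_smul (hk : k ≠ 0) (hXZ : ∀ p, X (k • p) = k • Z p)
    (h : IsPeriodicOrbit Z Γ) : IsPeriodicOrbit X ((k • ·) '' Γ) := by
  obtain ⟨γ, T, hT, hγ, hper, ⟨t, ht⟩, rfl⟩ := h
  refine ⟨fun t => k • γ t, T, hT, fun t => ?_, fun t => ?_, ⟨t, fun h => ?_⟩, ?_⟩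
  · simp only [hXZ]
    exact (hγ t).const_smul k
  · simp only [hper t]
  · exact ht (smul_right_injective _ hk h)
  · exact (range_comp _ γ).symm

theorem IsLimitCycle.image_smul (hk : k ≠ 0) (hXZ : ∀ p, X (k • p) = k • Z p)
    (h : IsLimitCycle Z Γ) : IsLimitCycle X ((k • ·) '' Γ) := by
  obtain ⟨hΓ, U, hU, hΓU, huniq⟩ := h
  have hinv : ∀ p, Z (k⁻¹ • p) = k⁻¹ • X p := fun p => by
    rw [eq_inv_smul_iff₀ hk, ← hXZ, smul_inv_smul₀ hk]
  refine ⟨hΓ.image_smul hk hXZ, (k • ·) '' U, isOpenMap_smul₀ hk U hU, image_mono hΓU,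
    fun Γ' hΓ' hsub => ?_⟩
  have hpull : (k⁻¹ • ·) '' Γ' = Γ := by
    refine huniq _ (hΓ'.image_smul (inv_ne_zero hk) hinv) ?_
    rintro _ ⟨p, hp, rfl⟩
    obtain ⟨q, hq, rfl⟩ := hsub hp
    simpa only [inv_smul_smul₀ hk] using hq
  simp only [← hpull, image_image, smul_inv_smul₀ hk, image_id']

theorem IsPeriodicOrbit.nonempty (h : IsPeriodicOrbit X Γ) : Γ.Nonempty := by
  obtain ⟨γ, -, -, -, -, -, rfl⟩ := h
  exact range_nonempty γ

theorem encard_le_encard_isLimitCycle {U : Set (ℝ × ℝ)} {s : Set ℕ} (f : ℝ × ℝ → ℝ)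
    (h : ∀ n ∈ s, ∃ Γ, (IsLimitCycle X Γ ∧ Γ ⊆ U) ∧ ∀ p ∈ Γ, |f p - n| < 1 / 2) :
    s.encard ≤ {Γ | IsLimitCycle X Γ ∧ Γ ⊆ U}.encard := by
  choose! Γ hΓ hf using h
  have hinj : InjOn Γ s := fun m hm n hn hmn => by
    obtain ⟨p, hp⟩ := (hΓ m hm).1.1.nonempty
    have hm' := abs_lt.1 (hf m hm p hp)
    have hn' := abs_lt.1 (hf n hn p (hmn ▸ hp))
    have hlt : (m : ℝ) < n + 1 := by linarith [hm'.1, hn'.2]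
    have hgt : (n : ℝ) < m + 1 := by linarith [hm'.2, hn'.1]
    norm_cast at hlt hgt
    lia
  rw [← hinj.encard_image]
  exact encard_le_encard (image_subset_iff.2 hΓ)

end Scaling

section RayleighLienard

/-- The coefficients for which, if `m = -b / a ^ 2`, the scaling by `k` turns the
Rayleigh–Liénard system into the oscillator with force `unfoldingForce (m * k ^ 2)`. -/
noncomputable def unfoldingCoeff (m ε μ : ℝ) : Fin 6 → ℝ :=
  ![m ^ 2 * (420 * μ ^ 3 + 3675 * μ ^ 9 * (160 - 1500 * μ + 23625 * μ ^ 3)) / ε,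
    m * (-210 * μ ^ 3 - 3675 * 14385 * μ ^ 13) / ε,
    3675 * 1575 * μ ^ 14 / ε,
    70 * m * μ ^ 3 / ε,
    m ^ 3 * (3675 * μ ^ 8 * (-400 * μ + 4800 * μ ^ 2 - 14280 * μ ^ 3)) / ε,
    m ^ 2 * (3675 * μ ^ 9 * (-32 + 300 * μ)) / ε]

theorem tendsto_unfoldingCoeff (m ε : ℝ) : Tendsto (unfoldingCoeff m ε) (𝓝 0) (𝓝 0) := by
  have hcont : Continuous (unfoldingCoeff m ε) := by
    unfold unfoldingCoeff
    fun_prop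
  have hzero : unfoldingCoeff m ε 0 = 0 := by
    ext i
    fin_cases i <;> simp [unfoldingCoeff]
  simpa only [hzero] using hcont.tendsto 0

theorem rayleighLienardField_smul {a b ε : ℝ} (hε : ε ≠ 0) (k : ℝ) (p : ℝ × ℝ) :
    rayleighLienardField a b ε (unfoldingCoeff (-b / a ^ 2) ε (-b / a ^ 2 * k ^ 2)) (k • p)
      = k • oscField (fun p => unfoldingForce (-b / a ^ 2 * k ^ 2) p.1 p.2) p := by
  have hcubic : 2 * b / a ^ 2 = -2 * (-b / a ^ 2) := by ring
  simp only [rayleighLienardField, hcubic]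
  generalize -b / a ^ 2 = m
  ext
  · simp [oscField]
  · simp [oscField, unfoldingForce, totalDamping, exactDamping, unfoldingDamping, unfoldingCoeff]
    field_simp
    ring

theorem tendsto_const_mul_sq_nhdsNE {m : ℝ} (hm : m ≠ 0) :
    Tendsto (fun k => m * k ^ 2) (𝓝[≠] 0) (𝓝[≠] 0) := by
  refine tendsto_nhdsWithin_iff.2 ⟨?_, ?_⟩
  · have hcont : Continuous fun k : ℝ => m * k ^ 2 := by fun_prop
    simpa using (hcont.tendsto 0).mono_left nhdsWithin_le_nhds
  · filter_upwards [self_mem_nhdsWithin] with k hk using mul_ne_zero hm (pow_ne_zero 2 hk)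

theorem eventually_mapsTo_smul_of_mem_nhds_zero {U : Set (ℝ × ℝ)} (hU : U ∈ 𝓝 0) (r : ℝ) :
    ∀ᶠ k in 𝓝 (0 : ℝ), MapsTo (k • ·) {p : ℝ × ℝ | p.1 ^ 2 + p.2 ^ 2 < r} U := by
  have hbdd : Bornology.IsBounded {p : ℝ × ℝ | p.1 ^ 2 + p.2 ^ 2 < r} := by
    refine isBounded_iff_forall_norm_le.2 ⟨√r, fun p (hp : _ < r) => ?_⟩
    exact max_le (abs_le_sqrt (by nlinarith [sq_nonneg p.2]))
      (abs_le_sqrt (by nlinarith [sq_nonneg p.1]))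
  exact (NormedSpace.isVonNBounded_of_isBounded ℝ hbdd hU).eventually_nhds_zero
    (mem_of_mem_nhds hU)

theorem mainTheorem2_general (a b ε : ℝ) (ha : a ≠ 0) (hb : b ≠ 0) (hε : ε ≠ 0) :
    LimitCyclesBifurcate (fun d : Fin 6 → ℝ => rayleighLienardField a b ε d)
      (0 : Fin 6 → ℝ) ((0, 0) : ℝ × ℝ) 5 := by
  intro U hU W hW
  have hm : -b / a ^ 2 ≠ 0 := div_ne_zero (neg_ne_zero.2 hb) (pow_ne_zero 2 ha)
  have htendsto := tendsto_const_mul_sq_nhdsNE hm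
  have hcycles := htendsto.eventually
    ((finite_Ioo 0 6).eventually_all.2 fun n hn => eventually_exists_isLimitCycle_unfoldingForce hn)
  have hcoeff := htendsto.eventually
    (((tendsto_unfoldingCoeff (-b / a ^ 2) ε).mono_left nhdsWithin_le_nhds).eventually_mem hW)
  have hsmall := (eventually_mapsTo_smul_of_mem_nhds_zero hU 6).filter_mono
    (nhdsWithin_le_nhds (s := {0}ᶜ))
  obtain ⟨k, ⟨hcycles, hcoeff⟩, hsmall, hk : k ≠ 0⟩ :=
    ((hcycles.and hcoeff).and (hsmall.and self_mem_nhdsWithin)).exists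
  refine ⟨_, hcoeff, ?_⟩
  have hcard : ((5 : ℕ) : ℕ∞) = (Ioo 0 6 : Set ℕ).encard := by
    rw [← Finset.coe_Ioo, encard_coe_eq_coe_finsetCard, Nat.card_Ioo]
  rw [hcard]
  refine encard_le_encard_isLimitCycle
    (fun p => (k⁻¹ • p).1 ^ 2 + (k⁻¹ • p).2 ^ 2) fun n hn => ?_
  obtain ⟨Γ, hΓ, hnear⟩ := hcycles n hn
  have hn5 : (n : ℝ) ≤ 5 := mod_cast Nat.lt_succ_iff.1 hn.2
  have hsub : Γ ⊆ {p | p.1 ^ 2 + p.2 ^ 2 < 6} := fun p hp =>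
    show _ < (6 : ℝ) by linarith [(abs_lt.1 (hnear p hp)).2]
  refine ⟨_, ⟨hΓ.image_smul hk (rayleighLienardField_smul hε k),
    (hsmall.mono_left hsub).image_subset⟩, forall_mem_image.2 fun p hp => ?_⟩
  simpa only [inv_smul_smul₀ hk] using hnear p hp

end RayleighLienard

theorem mainTheorem2 (a b ε : ℝ) (ha : 0 < a) (hb : b < 0) (hε : ε ≠ 0) :
    LimitCyclesBifurcate (fun d : Fin 6 → ℝ => rayleighLienardField a b ε d)
      (0 : Fin 6 → ℝ) ((0, 0) : ℝ × ℝ) 5 :=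
  mainTheorem2_general a b ε ha.ne' hb.ne hε
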